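/- **Setting.** Let $\phi$ be the ReLU. A network $\theta=(A_1,\dots,A_d)$, $d\ge 2$, $A_i\in\mathbb R^{h_i\times h_{i-1}}$, has preactivations $x^0=x$, $x^1=A_1x$, $x^i=A_i\phi(x^{i-1})$ for $2\le i\le d$, and output $f_\theta(x)=x^d$. Put $h_{\min}=\min_{1\le i\le d-1}h_i$. Let $S$ be a finite non-empty set of pairs $(x,y)\in\mathbb R^{h_0}\times\mathbb R^{h_d}$, let $l(y,\hat y)$ be $\beta$-Lipschitz in $\hat y$, and let $L(\theta)=\frac1{|S|}\sum_{(x,y)\in S}l(y,f_\theta(x))$. $\|\cdot\|$ is the $\ell_2$ norm of vectors and the operator norm of matrices, $\|\cdot\|_F$ the Frobenius norm, and $[A]_j$ the $j$-th column of $A$. Dropout with probability $p$ replaces $A_i$ ($2\le i\le d$) by $\hat A_i$ with columns $[\hat A_i]_j=\delta_{ij}[A_i]_j$, where all $\delta_{ij}$ are independent, equal to $0$ with probability $p$ and to $\frac1{1-p}$ with probability $1-p$. Let $\theta^i=(A_1,\hat A_2,\dots,\hat A_i,A_{i+1},\dots,A_d)$ and $\theta_1=\theta^d$. For $t\in[0,1]$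 let $\hat x^i_i(t)$ and $\hat x^i_{i-1}(t)$ be the preactivations at layer $i$ of the networks $t\theta+(1-t)\theta^i$ and $t\theta+(1-t)\theta^{i-1}$ on input $x$. Let $M^{i,j}$ be the map with $x^j=M^{i,j}(x^i)$ and $J^{i,j}_{x^i}$ its Jacobian at $x^i$, computed by the chain rule with $\phi'(0)=0$. Write $\min_x,\max_x$ for extrema over the inputs of $S$, and put $$\mu_i=\min_{x}\frac{\|A_i\phi(x^{i-1})\|}{\|A_i\|_F\|\phi(x^{i-1})\|},\quad \mu_{i\to}=\min_{i\le j\le d}\min_{x}\frac{\|J^{i,j}_{x^i}x^i\|}{\|J^{i,j}_{x^i}\|\|x^i\|},\quad c=\max_{x,\,1\le i\le d-1}\frac{\|x^i\|}{\|\phi(x^i)\|},$$ $$\epsilon=\frac{\beta\,c\,d^{3/2}\max_{x}\|f_\theta(x)\|}{h_{\min}^{1/2}\,\min_{2\le i\le d}\mu_i\mu_{i\to}},\qquad \Lambda=\log\Big(3+|S|+d+\max_{x}\|x\|+\frac{\beta}{\epsilon}+\sum_{i=1}^d(h_i+\|A_i\|)\Big).$$ **Statement.** There is a universal $k\in\mathbb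 N$ such that for every $K>0$ there is a constant $C>0$, depending only on $K$, with the following property for all $d,h_i,l,\beta,S,\theta,p$. Assume: 1. ($\theta$ is $\epsilon$-noise stable.) $f_\theta(x)\ne0$ for every input $x$ of $S$ (equivalently, the quantities above are well defined); $h_{\min}\ge C\Lambda^k$; and for some $\rho\ge3d$, with probability at least $1/2$ over the dropout, the following hold simultaneously for all inputs $x$ of $S$ and all $0\le t\le1$: - for all $2\le i\le j\le d$ and both $v=\hat x^i_i(t)$ and $v=\hat x^i_{i-1}(t)$: $\ \|M^{i,j}(v)-J^{i,j}_{x^i}v\|\le\frac{\|v-x^i\|\|x^j\|}{\rho\|x^i\|}$; - for all $1\le i\le d-1$: $\ \|\phi(\hat x^i_i(t))\|_\infty\le\frac{K}{\sqrt{h_i}}\|\phi(\hat x^i_i(t))\|$. 2. $C\Lambda^k/h_{\min}<p\le\frac34$. 3. $\|[A_i]_j\|\le K\sqrt p\,\|A_i\|_F$ for all $2\le i\le d$, $1\le j\le h_{i-1}$. 4. $\sqrt p\,\epsilon\,\Lambda^k\le K\beta\max_{x}\|f_\theta(x)\|$. Then, with probability at least $1/4$ over the dropout, for every $0\le t\le1$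 the network $\theta_t=\theta+t(\theta_1-\theta)$ satisfies $$L(\theta_t)\le L(\theta)+C\sqrt p\,\epsilon\,\Lambda^k .$$ In particular, if $p=\frac34$, then $\theta$ is dropout stable in the following sense: one can keep at most $\lfloor h_i/2\rfloor$ units in each hidden layer $i$, multiply their outputs by a common factor, set the outputs of all other hidden units to zero, and obtain a network of loss at most $L(\theta)+C\sqrt p\,\epsilon\,\Lambda^k$. -/

import Mathlib

open MeasureTheory
open scoped Matrix.Norms.L2Operator

noncomputable section

namespace ReluNet

/-- Euclidean space `ℝⁿ` with the `ℓ₂` norm. -/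
abbrev Vec (n : ℕ) := EuclideanSpace ℝ (Fin n)

/-- Parameters of a fully connected network with layer widths `h 0` (input), `h 1`, `h 2`, ….
The matrix `θ i` has size `h (i+1) × h i`; it is the weight matrix `A_{i+1}` of layer `i+1`.
A network with `d` layers only uses `θ 0, …, θ (d-1)`. -/
abbrev Params (h : ℕ → ℕ) := (i : ℕ) → Matrix (Fin (h (i + 1))) (Fin (h i)) ℝ

/-- The ReLU activation, coordinatewise. -/
def relu {n : ℕ} (v : Vec n) : Vec n := WithLp.toLp 2 fun k => max (v k) 0

/-- What is fed into the weight matrix of layer `i+1`: the input itself for `i = 0`, and the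
ReLU of the preactivation of layer `i` for `i ≥ 1`. -/
def act {h : ℕ → ℕ} : (i : ℕ) → Vec (h i) → Vec (h i)
  | 0, v => v
  | _ + 1, v => relu v

/-- Coordinatewise derivative of `act i` at `v`, with the convention `ReLU'(0) = 0`. -/
def actDeriv {h : ℕ → ℕ} : (i : ℕ) → Vec (h i) → Fin (h i) → ℝ
  | 0, _ => fun _ => 1
  | _ + 1, v => fun k => if 0 < v k then 1 else 0

/-- The map from the preactivation of layer `i` to the preactivation of layer `i+1`. -/
def step {h : ℕ → ℕ} (θ : Params h) (i : ℕ) (v : Vec (h i)) : Vec (h (i + 1)) :=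
  Matrix.toEuclideanLin (θ i) (act i v)

/-- The vector `x^i` before activation at layer `i` on input `x` (with `x^0 = x`). -/
def preact {h : ℕ → ℕ} (θ : Params h) (x : Vec (h 0)) : (i : ℕ) → Vec (h i)
  | 0 => x
  | i + 1 => step θ i (preact θ x i)

/-- The function `f_θ` computed by the network with `d` layers. -/
def output {h : ℕ → ℕ} (d : ℕ) (θ : Params h) (x : Vec (h 0)) : Vec (h d) := preact θ x d

/-- The operator `M^{i,i+k}` composing the layers after `i` up to `i+k`. -/
def layerMap {h : ℕ → ℕ} (θ : Params h) (i : ℕ) : (k : ℕ) → Vec (h i) → Vec (h (i + k))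
  | 0, v => v
  | k + 1, v => step θ (i + k) (layerMap θ i k v)

/-- The Jacobian of `M^{i,i+k}` at `v`, by the chain rule. -/
def jacobian {h : ℕ → ℕ} (θ : Params h) (i : ℕ) :
    (k : ℕ) → Vec (h i) → Matrix (Fin (h (i + k))) (Fin (h i)) ℝ
  | 0, _ => 1
  | k + 1, v =>
      θ (i + k) * Matrix.diagonal (actDeriv (i + k) (layerMap θ i k v)) * jacobian θ i k v

/-- The Frobenius norm. (The notation `‖A‖` for a matrix is the operator norm for `ℓ₂`.) -/
def frob {m n : ℕ} (A : Matrix (Fin m) (Fin n) ℝ) : ℝ := Real.sqrt (∑ r, ∑ j, A r j ^ 2)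

/-- The `j`-th column of a matrix, as a Euclidean vector. -/
def column {m n : ℕ} (A : Matrix (Fin m) (Fin n) ℝ) (j : Fin n) : Vec m :=
  WithLp.toLp 2 fun r => A r j

/-- Multiply the `j`-th column of `A` by `s j`. -/
def scaleColumns {m n : ℕ} (A : Matrix (Fin m) (Fin n) ℝ) (s : Fin n → ℝ) :
    Matrix (Fin m) (Fin n) ℝ :=
  Matrix.of fun r j => s j * A r j

/-- The training set: finitely many pairs (input, label). -/
abbrev Sample (d : ℕ) (h : ℕ → ℕ) := Finset (Vec (h 0) × Vec (h d))

/-- The empirical loss `L(θ) = (1/|S|) ∑_{(x,y) ∈ S} l(y, f_θ(x))`. -/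
def loss {d : ℕ} {h : ℕ → ℕ} (l : Vec (h d) → Vec (h d) → ℝ) (S : Sample d h)
    (θ : Params h) : ℝ :=
  (1 / (S.card : ℝ)) * ∑ z ∈ S, l z.2 (output d θ z.1)

/-! ### Dropout -/

/-- Outcomes of the dropout of layers `2, …, d`: for every hidden layer `i+1` (`1 ≤ i+1 ≤ d-1`)
and every unit `j` of it, `true` if column `j` of `A_{i+2}` is kept, `false` if it is dropped. -/
abbrev Mask (d : ℕ) (h : ℕ → ℕ) := (i : Fin (d - 1)) → Fin (h (i + 1)) → Bool

/-- Law of one bit: dropped with probability `p`, kept with probability `1 - p`. -/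
def bitLaw (p : ℝ) : Measure Bool :=
  ENNReal.ofReal p • Measure.dirac false + ENNReal.ofReal (1 - p) • Measure.dirac true

/-- Law of the dropout outcome: all bits are independent. -/
def dropoutLaw (d : ℕ) (h : ℕ → ℕ) (p : ℝ) : Measure (Mask d h) :=
  Measure.pi fun i => Measure.pi fun _ : Fin (h (i + 1)) => bitLaw p

/-- The multiplier of a column: `0` if dropped and `1/(1-p)` if kept. -/
def multiplier (p : ℝ) (b : Bool) : ℝ := if b then 1 / (1 - p) else 0

/-- The parameters `θ^n = (A₁, Â₂, …, Â_n, A_{n+1}, …, A_d)` obtained from `θ` by dropping out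
the columns of the weight matrices of layers `2, …, n` (`n ≤ d`). Recall `θ (i+1) = A_{i+2}`. -/
def dropUpTo {d : ℕ} {h : ℕ → ℕ} (p : ℝ) (w : Mask d h) (θ : Params h) (n : ℕ) : Params h
  | 0 => θ 0
  | i + 1 =>
      if hi : i < d - 1 then
        if i + 2 ≤ n then scaleColumns (θ (i + 1)) fun j => multiplier p (w ⟨i, hi⟩ j)
        else θ (i + 1)
      else θ (i + 1)

/-- The point `θ + t (θ' - θ)` of the segment from `θ` to `θ'`. -/
def onSegment {h : ℕ → ℕ} (θ θ' : Params h) (t : ℝ) : Params h := θ + t • (θ' - θ)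

/-- Dropout stability: one can keep at most half of the units in each hidden layer, multiply
their outputs by a common factor `r`, set the outputs of all other hidden units to zero
(that is, scale the columns of the next weight matrix accordingly), and thereby increase the
loss by at most `η`. -/
def IsDropoutStable {d : ℕ} {h : ℕ → ℕ} (l : Vec (h d) → Vec (h d) → ℝ) (S : Sample d h)
    (θ : Params h) (η : ℝ) : Prop :=
  ∃ (r : ℝ) (U : (i : ℕ) → Finset (Fin (h i))) (θ' : Params h),
    (∀ i, 1 ≤ i → i < d → (U i).card ≤ h i / 2) ∧
    θ' 0 = θ 0 ∧
    (∀ i, 1 ≤ i → i < d → θ' i = scaleColumns (θ i) fun j => if j ∈ U i then r else 0) ∧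
    loss l S θ' ≤ loss l S θ + η

/-! ### Noise stability quantities -/

/-- The minimum width `h_min` of the hidden layers `1, …, d-1`. -/
def minWidth (d : ℕ) (h : ℕ → ℕ) : ℕ := ⨅ i : Fin (d - 1), h (i + 1)

/-- The layer cushion `μ_{i+1}` of layer `i+1`. -/
def layerCushion {d : ℕ} {h : ℕ → ℕ} (S : Sample d h) (θ : Params h) (i : ℕ) : ℝ :=
  ⨅ z : S, ‖Matrix.toEuclideanLin (θ i) (act i (preact θ z.1.1 i))‖ /
    (frob (θ i) * ‖act i (preact θ z.1.1 i)‖)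

/-- The interlayer cushion `μ_{i,i+k}`. -/
def interlayerCushion {d : ℕ} {h : ℕ → ℕ} (S : Sample d h) (θ : Params h) (i k : ℕ) : ℝ :=
  ⨅ z : S, ‖Matrix.toEuclideanLin (jacobian θ i k (preact θ z.1.1 i)) (preact θ z.1.1 i)‖ /
    (‖jacobian θ i k (preact θ z.1.1 i)‖ * ‖preact θ z.1.1 i‖)

/-- The minimal interlayer cushion `min_{i ≤ j ≤ d} μ_{i,j}` of layer `i`. -/
def minInterlayerCushion {d : ℕ} {h : ℕ → ℕ} (S : Sample d h) (θ : Params h) (i : ℕ) : ℝ :=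
  ⨅ k : Fin (d - i + 1), interlayerCushion S θ i k

/-- `min_{2 ≤ i ≤ d}` of (layer cushion of `i`) · (minimal interlayer cushion of `i`). -/
def minCushion {d : ℕ} {h : ℕ → ℕ} (S : Sample d h) (θ : Params h) : ℝ :=
  ⨅ i : Fin (d - 1), layerCushion S θ (i + 1) * minInterlayerCushion S θ (i + 2)

/-- The activation contraction `c = max ‖x^i‖ / ‖φ(x^i)‖` over `x ∈ S`, `1 ≤ i ≤ d-1`. -/
def activationContraction {d : ℕ} {h : ℕ → ℕ} (S : Sample d h) (θ : Params h) : ℝ :=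
  ⨆ z : S, ⨆ i : Fin (d - 1), ‖preact θ z.1.1 (i + 1)‖ / ‖relu (preact θ z.1.1 (i + 1))‖

/-- `max_{x ∈ S} ‖x‖`. -/
def maxInput {d : ℕ} {h : ℕ → ℕ} (S : Sample d h) : ℝ := ⨆ z : S, ‖z.1.1‖

/-- `max_{x ∈ S} ‖f_θ(x)‖`. -/
def maxOutput {d : ℕ} {h : ℕ → ℕ} (S : Sample d h) (θ : Params h) : ℝ :=
  ⨆ z : S, ‖output d θ z.1.1‖

/-- The two interlayer smoothness inequalities with constant `ρ`, for the dropout outcome `w`,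
for all `2 ≤ i ≤ j = i + k ≤ d`, all inputs, and all points `t` of the segments. The vectors
`x̂^i_i(t)` and `x̂^i_{i-1}(t)` are the preactivations at layer `i` of the networks on the
segments between `θ` and `θ^i`, and between `θ` and `θ^{i-1}`. -/
def SmoothFor {d : ℕ} {h : ℕ → ℕ} (S : Sample d h) (θ : Params h) (p ρ : ℝ)
    (w : Mask d h) : Prop :=
  ∀ z ∈ S, ∀ i k : ℕ, 2 ≤ i → i + k ≤ d → ∀ n : ℕ, n = i ∨ n + 1 = i →
    ∀ t ∈ Set.Icc (0 : ℝ) 1,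
      ‖layerMap θ i k (preact (onSegment θ (dropUpTo p w θ n) t) z.1 i) -
          Matrix.toEuclideanLin (jacobian θ i k (preact θ z.1 i))
            (preact (onSegment θ (dropUpTo p w θ n) t) z.1 i)‖ ≤
        ‖preact (onSegment θ (dropUpTo p w θ n) t) z.1 i - preact θ z.1 i‖ *
            ‖preact θ z.1 (i + k)‖ /
          (ρ * ‖preact θ z.1 i‖)

/-- For the dropout outcome `w`, the activations `φ(x̂^i_i(t))`, `1 ≤ i ≤ d-1`, are spread out:
`‖φ(x̂^i_i(t))‖_∞ ≤ (K / √h_i) ‖φ(x̂^i_i(t))‖`. -/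
def SpreadFor {d : ℕ} {h : ℕ → ℕ} (S : Sample d h) (θ : Params h) (p K : ℝ)
    (w : Mask d h) : Prop :=
  ∀ z ∈ S, ∀ i : ℕ, 1 ≤ i → i < d → ∀ t ∈ Set.Icc (0 : ℝ) 1, ∀ j : Fin (h i),
    |relu (preact (onSegment θ (dropUpTo p w θ i) t) z.1 i) j| ≤
      K / Real.sqrt (h i) * ‖relu (preact (onSegment θ (dropUpTo p w θ i) t) z.1 i)‖

/-- The noise stability parameter
`ε = β c d^{3/2} max_x ‖f_θ(x)‖ / (h_min^{1/2} min_{2 ≤ i ≤ d} (μ_i μ_{i→}))`. -/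
def noiseParameter {d : ℕ} {h : ℕ → ℕ} (S : Sample d h) (θ : Params h) (β : ℝ) : ℝ :=
  β * activationContraction S θ * (d : ℝ) ^ (3 / 2 : ℝ) * maxOutput S θ /
    (Real.sqrt (minWidth d h) * minCushion S θ)

/-- `θ` is `ε`-noise stable, for dropout probability `p`, hidden constant `K` in the spreading
condition, and required minimum width `H`.

The first field says that `ε` is well defined: given it, no denominator in the definition of
the cushions, of the activation contraction and of `ε` vanishes, and conversely.
The last field says that the interlayer smoothness `ρ` is at least `3d`. The activations
in the spreading condition are random too; that condition is only asked for together with the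
smoothness inequalities, on an event of probability at least `1/2`. -/
structure IsNoiseStable {d : ℕ} {h : ℕ → ℕ} (S : Sample d h) (θ : Params h)
    (β p K H ε : ℝ) : Prop where
  output_ne_zero : ∀ z ∈ S, output d θ z.1 ≠ 0
  eps_eq : ε = noiseParameter S θ β
  width : H ≤ (minWidth d h : ℝ)
  smooth : ∃ ρ : ℝ, 3 * (d : ℝ) ≤ ρ ∧
    1 / 2 ≤ (dropoutLaw d h p).real {w | SmoothFor S θ p ρ w ∧ SpreadFor S θ p K w}

/-- The logarithm whose powers are the poly-logarithmic factors: the factors inside are `|S|`,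
`d`, `max ‖x‖`, `β/ε`, the widths `h_i`, and the norms `‖A_i‖`, `1 ≤ i ≤ d`. -/
def logFactor {d : ℕ} {h : ℕ → ℕ} (S : Sample d h) (θ : Params h) (β ε : ℝ) : ℝ :=
  Real.log (3 + (S.card : ℝ) + (d : ℝ) + maxInput S + β / ε +
    ∑ i ∈ Finset.range d, ((h (i + 1) : ℝ) + ‖θ i‖))

end ReluNet

end

/-! Passing from `θ^{i-1}` to `θ^i` injects at layer `i` the noise `(Â_i - A_i) φ(x̂^{i-1})`, a sum
of independent centered vectors, one for each column of `A_i`. Spread activations and small columns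
make each summand small, and a Pinelis-type bound on exponential moments, valid in any Hilbert
space, shows that the noise is of size `√(p / h_min)` relative to `‖A_i‖_F ‖φ(x̂^{i-1})‖`. As this
holds conditionally on the previous layers, the noise sizes of all layers, once truncated where the
activations are not spread out, have a sum with an exponential tail.

Interlayer smoothness makes the layers after `i` act on this noise like the Jacobian of the original
network at `x^i`, and the cushions bound its effect on every later layer relative to `‖x^j‖`.
Adding the layers up by a discrete Grönwall inequality bounds the relative error of the output
exponentially in the total noise. A union bound over a fine grid of times `t`, whose mesh is small
compared with the Lipschitz constant of the network in `t`, gives the estimate on the whole segment.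

For `p = 3/4` each hidden layer keeps in expectation a quarter of its units, hence by Hoeffding's
inequality at most half of them in all layers at once with probability more than `3/4`; some outcome
therefore also satisfies the loss bound, which holds with probability at least `1/4`.
-/

namespace ReluNet

section UpdateOneCoordinate

variable {ι : Type*} [Fintype ι] [DecidableEq ι] {α : ι → Type*} [∀ i, MeasurableSpace (α i)]
  (μ : ∀ i, Measure (α i)) [∀ i, IsProbabilityMeasure (μ i)]

theorem measurePreserving_update (i : ι) :
    MeasurePreserving (fun z : (∀ j, α j) × α i => Function.update z.1 i z.2)
      ((Measure.pi μ).prod (μ i)) (Measure.pi μ) := by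
  have hmeas : Measurable fun z : (∀ j, α j) × α i => Function.update z.1 i z.2 :=
    measurable_update'
  refine ⟨hmeas, (Measure.pi_eq fun s hs => ?_).symm⟩
  have hpre : (fun z : (∀ j, α j) × α i => Function.update z.1 i z.2) ⁻¹' Set.univ.pi s =
      Set.univ.pi (Function.update s i Set.univ) ×ˢ s i := by
    ext ⟨w, a⟩
    simp only [Set.mem_preimage, Set.mem_univ_pi, Set.mem_prod]
    grind
  have hother : ∀ j ∈ Finset.univ.erase i, μ j (Function.update s i Set.univ j) = μ j (s j) :=
    fun j hj => by rw [Function.update_of_ne (Finset.ne_of_mem_erase hj)]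
  rw [Measure.map_apply hmeas (.univ_pi hs), hpre, Measure.prod_prod, Measure.pi_pi,
    ← Finset.prod_erase_mul _ _ (Finset.mem_univ i), Finset.prod_congr rfl hother,
    Function.update_self, measure_univ, mul_one, Finset.prod_erase_mul _ _ (Finset.mem_univ i)]

theorem integral_integral_update {f : (∀ i, α i) → ℝ} (hf : Integrable f (Measure.pi μ)) (i : ι) :
    ∫ w, ∫ a, f (Function.update w i a) ∂μ i ∂Measure.pi μ = ∫ w, f w ∂Measure.pi μ := by
  have hmp := measurePreserving_update μ i
  have hf' := hmp.map_eq.symm ▸ hf.aestronglyMeasurable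
  calc ∫ w, ∫ a, f (Function.update w i a) ∂μ i ∂Measure.pi μ
      = ∫ z, f (Function.update z.1 i z.2) ∂(Measure.pi μ).prod (μ i) :=
        (integral_prod _ (hmp.integrable_comp_of_integrable hf)).symm
    _ = ∫ w, f w ∂Measure.pi μ := by rw [← integral_map hmp.aemeasurable hf', hmp.map_eq]

theorem integral_le_mul_integral_of_update {f g : (∀ i, α i) → ℝ}
    (hf : Integrable f (Measure.pi μ)) (hg : Integrable g (Measure.pi μ)) (i : ι) {c : ℝ}
    (hfg : ∀ w, ∫ a, f (Function.update w i a) ∂μ i ≤ c * g w) :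
    ∫ w, f w ∂Measure.pi μ ≤ c * ∫ w, g w ∂Measure.pi μ := by
  have hmp := measurePreserving_update μ i
  rw [← integral_integral_update μ hf i, ← integral_const_mul]
  refine integral_mono (hmp.integrable_comp_of_integrable hf).integral_prod_left
    (hg.const_mul c) hfg

end UpdateOneCoordinate

section Adapted

variable {ι : Type*} [Fintype ι] [LinearOrder ι] {α : ι → Type*} [∀ i, MeasurableSpace (α i)]
  (μ : ∀ i, Measure (α i)) [∀ i, IsProbabilityMeasure (μ i)] {N : ι → (∀ i, α i) → ℝ} {C : ℝ}

theorem integral_exp_sum_le_pow_card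
    (hadapted : ∀ i j, i < j → ∀ w a, N i (Function.update w j a) = N i w)
    (hmoment : ∀ i w, ∫ a, Real.exp (N i (Function.update w i a)) ∂μ i ≤ C)
    (hint : ∀ s : Finset ι, Integrable (fun w => Real.exp (∑ i ∈ s, N i w)) (Measure.pi μ))
    (s : Finset ι) :
    ∫ w, Real.exp (∑ i ∈ s, N i w) ∂Measure.pi μ ≤ C ^ s.card := by
  induction s using Finset.induction_on_max with
  | empty => simp
  | insert i s hmax ih =>
    have hi : i ∉ s := fun h => (hmax i h).false
    have hupdate : ∀ w a, Real.exp (∑ j ∈ insert i s, N j (Function.update w i a)) =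
        Real.exp (N i (Function.update w i a)) * Real.exp (∑ j ∈ s, N j w) := by
      intro w a
      rw [Finset.sum_insert hi, Real.exp_add,
        Finset.sum_congr rfl fun j hj => hadapted j i (hmax j hj) w a]
    have hC : 0 ≤ C := by
      obtain ⟨w⟩ := (Measure.pi μ).nonempty_of_neZero
      exact (integral_nonneg fun _ => (Real.exp_pos _).le).trans (hmoment i w)
    rw [Finset.card_insert_of_notMem hi, pow_succ']
    refine (integral_le_mul_integral_of_update μ (hint _) (hint s) i fun w => ?_).trans
      (mul_le_mul_of_nonneg_left ih hC)
    simp only [hupdate]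
    rw [integral_mul_const]
    exact mul_le_mul_of_nonneg_right (hmoment i w) (Real.exp_pos _).le

theorem measureReal_le_sum_le
    (hadapted : ∀ i j, i < j → ∀ w a, N i (Function.update w j a) = N i w)
    (hmoment : ∀ i w, ∫ a, Real.exp (N i (Function.update w i a)) ∂μ i ≤ C)
    (hint : ∀ s : Finset ι, Integrable (fun w => Real.exp (∑ i ∈ s, N i w)) (Measure.pi μ))
    (T : ℝ) :
    (Measure.pi μ).real {w | T ≤ ∑ i, N i w} ≤ Real.exp (-T) * C ^ Fintype.card ι := by
  have hchernoff := ProbabilityTheory.measure_ge_le_exp_mul_mgf (μ := Measure.pi μ)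
    (X := fun w => ∑ i, N i w) T zero_le_one (by simpa using hint Finset.univ)
  simp only [ProbabilityTheory.mgf, neg_mul, one_mul] at hchernoff
  exact hchernoff.trans (by
    gcongr; exact integral_exp_sum_le_pow_card μ hadapted hmoment hint Finset.univ)

end Adapted

section ExpNorm

theorem integrable_exp_sqrt_one_add_norm_sq {E : Type*} [NormedAddCommGroup E] {α : Type*}
    [MeasurableSpace α] {μ : Measure α} [IsFiniteMeasure μ] {Y : α → E}
    (hY : AEStronglyMeasurable Y μ) {C : ℝ} (hbound : ∀ a, ‖Y a‖ ≤ C) :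
    Integrable (fun a => Real.exp √(1 + ‖Y a‖ ^ 2)) μ := by
  have hcont : Continuous fun y : E => Real.exp √(1 + ‖y‖ ^ 2) := by fun_prop
  refine .of_bound (hcont.comp_aestronglyMeasurable hY) (Real.exp √(1 + C ^ 2))
    (ae_of_all _ fun a => ?_)
  rw [Real.norm_eq_abs, Real.abs_exp]
  gcongr
  exact hbound a

theorem integrable_exp_sqrt_one_add_norm_sum_sq {E : Type*} [NormedAddCommGroup E]
    {ι : Type*} [Fintype ι] {α : ι → Type*} [∀ i, MeasurableSpace (α i)] (μ : ∀ i, Measure (α i))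
    [∀ i, IsProbabilityMeasure (μ i)] {X : ∀ i, α i → E} (hX : ∀ i, StronglyMeasurable (X i))
    {C : ℝ} (hbound : ∀ i a, ‖X i a‖ ≤ C) (s : Finset ι) :
    Integrable (fun w : ∀ i, α i => Real.exp √(1 + ‖∑ i ∈ s, X i (w i)‖ ^ 2)) (Measure.pi μ) :=
  integrable_exp_sqrt_one_add_norm_sq
    (Finset.stronglyMeasurable_fun_sum s fun i _ =>
      (hX i).comp_measurable (measurable_pi_apply i)).aestronglyMeasurable
    fun w => norm_sum_le_of_le _ fun i _ => hbound i (w i)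

variable {E : Type*} [NormedAddCommGroup E] [InnerProductSpace ℝ E]

/- A smoothing of Pinelis' argument: `√(1 + ‖y‖²)` stands for `‖y‖`, and unlike the norm it has a
second order expansion at every point. -/
theorem exp_sqrt_one_add_norm_sq_add_le (y : E) {w : E} (hw : ‖w‖ ≤ 2 / 3) :
    Real.exp √(1 + ‖y + w‖ ^ 2) ≤
      Real.exp √(1 + ‖y‖ ^ 2) * (1 + inner ℝ y w / √(1 + ‖y‖ ^ 2) + 3 * ‖w‖ ^ 2) := by
  set R := √(1 + ‖y‖ ^ 2)
  have hR2 : R ^ 2 = 1 + ‖y‖ ^ 2 := Real.sq_sqrt (by positivity)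
  have hR1 : 1 ≤ R := Real.one_le_sqrt.2 (by nlinarith [sq_nonneg ‖y‖])
  have hyR : ‖y‖ ≤ R := Real.le_sqrt_of_sq_le (by linarith)
  have hw0 := norm_nonneg w
  set a := inner ℝ y w / R with ha
  have hinner : inner ℝ y w = a * R := by rw [ha]; field_simp
  obtain ⟨ha1, ha2⟩ : -‖w‖ ≤ a ∧ a ≤ ‖w‖ := by
    rw [← abs_le, ha, abs_div, abs_of_pos (by linarith : 0 < R), div_le_iff₀ (by linarith)]
    calc |inner ℝ y w| ≤ ‖y‖ * ‖w‖ := abs_real_inner_le_norm y w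
      _ ≤ ‖w‖ * R := by rw [mul_comm]; gcongr
  have hsqrt : √(1 + ‖y + w‖ ^ 2) ≤ R + (a + ‖w‖ ^ 2 / 2) := by
    rw [Real.sqrt_le_left (by nlinarith), norm_add_sq_real, hinner]
    nlinarith [sq_nonneg (a + ‖w‖ ^ 2 / 2), mul_nonneg (sub_nonneg.2 hR1) (sq_nonneg ‖w‖)]
  have hexp : Real.exp (a + ‖w‖ ^ 2 / 2) ≤ 1 + a + 3 * ‖w‖ ^ 2 := by
    have hsmall : |a + ‖w‖ ^ 2 / 2| ≤ 1 := abs_le.2 ⟨by nlinarith, by nlinarith⟩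
    have hsq : (a + ‖w‖ ^ 2 / 2) ^ 2 ≤ (4 / 3 * ‖w‖) ^ 2 := sq_le_sq' (by nlinarith) (by nlinarith)
    nlinarith [(abs_le.1 (Real.abs_exp_sub_one_sub_id_le hsmall)).2]
  calc Real.exp √(1 + ‖y + w‖ ^ 2) ≤ Real.exp (R + (a + ‖w‖ ^ 2 / 2)) := Real.exp_le_exp.2 hsqrt
    _ = Real.exp R * Real.exp (a + ‖w‖ ^ 2 / 2) := Real.exp_add _ _
    _ ≤ Real.exp R * (1 + a + 3 * ‖w‖ ^ 2) := by gcongr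

theorem integral_exp_sqrt_one_add_norm_sq_add_le [CompleteSpace E] {α : Type*} [MeasurableSpace α]
    {μ : Measure α} [IsProbabilityMeasure μ] {X : α → E} (hX : AEStronglyMeasurable X μ)
    (hbound : ∀ a, ‖X a‖ ≤ 2 / 3) (hmean : ∫ a, X a ∂μ = 0) (y : E) :
    ∫ a, Real.exp √(1 + ‖y + X a‖ ^ 2) ∂μ ≤
      Real.exp (3 * ∫ a, ‖X a‖ ^ 2 ∂μ) * Real.exp √(1 + ‖y‖ ^ 2) := by
  have hXint : Integrable X μ := .of_bound hX _ (ae_of_all _ hbound)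
  have hsq : Integrable (fun a => ‖X a‖ ^ 2) μ :=
    .of_bound (hX.norm.pow 2) ((2 / 3) ^ 2) (ae_of_all _ fun a => by
      rw [norm_pow, norm_norm]; gcongr; exact hbound a)
  have hlin : Integrable (fun a => inner ℝ y (X a) / √(1 + ‖y‖ ^ 2)) μ :=
    (hXint.const_inner y).div_const _
  have haffine : Integrable (fun a => 1 + inner ℝ y (X a) / √(1 + ‖y‖ ^ 2)) μ :=
    (integrable_const 1).add hlin
  calc ∫ a, Real.exp √(1 + ‖y + X a‖ ^ 2) ∂μ
      ≤ ∫ a, Real.exp √(1 + ‖y‖ ^ 2) *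
          (1 + inner ℝ y (X a) / √(1 + ‖y‖ ^ 2) + 3 * ‖X a‖ ^ 2) ∂μ :=
        integral_mono_of_nonneg (ae_of_all _ fun _ => (Real.exp_pos _).le)
          ((haffine.add (hsq.const_mul 3)).const_mul _)
          (ae_of_all _ fun a => exp_sqrt_one_add_norm_sq_add_le y (hbound a))
    _ = Real.exp √(1 + ‖y‖ ^ 2) * (3 * ∫ a, ‖X a‖ ^ 2 ∂μ + 1) := by
        rw [integral_const_mul, integral_add haffine (hsq.const_mul 3),
          integral_add (integrable_const 1) hlin, integral_div, integral_inner hXint,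
          hmean, inner_zero_right, integral_const_mul]
        simp [add_comm]
    _ ≤ Real.exp (3 * ∫ a, ‖X a‖ ^ 2 ∂μ) * Real.exp √(1 + ‖y‖ ^ 2) := by
        rw [mul_comm]
        gcongr
        exact Real.add_one_le_exp _

variable [CompleteSpace E] {ι : Type*} [Fintype ι] {α : ι → Type*} [∀ i, MeasurableSpace (α i)]
  (μ : ∀ i, Measure (α i)) [∀ i, IsProbabilityMeasure (μ i)] {X : ∀ i, α i → E}

theorem integral_exp_sqrt_one_add_norm_sum_sq_le (hX : ∀ i, StronglyMeasurable (X i))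
    (hbound : ∀ i a, ‖X i a‖ ≤ 2 / 3) (hmean : ∀ i, ∫ a, X i a ∂μ i = 0) (s : Finset ι) :
    ∫ w, Real.exp √(1 + ‖∑ i ∈ s, X i (w i)‖ ^ 2) ∂Measure.pi μ ≤
      Real.exp (1 + 3 * ∑ i ∈ s, ∫ a, ‖X i a‖ ^ 2 ∂μ i) := by
  classical
  induction s using Finset.induction_on with
  | empty => simp
  | insert i s hi ih =>
    have hupdate : ∀ (w : ∀ i, α i) a,
        ∑ j ∈ insert i s, X j (Function.update w i a j) = ∑ j ∈ s, X j (w j) + X i a := by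
      intro w a
      rw [Finset.sum_insert hi, Function.update_self, add_comm]
      exact congrArg (· + _) (Finset.sum_congr rfl fun j hj => by
        rw [Function.update_of_ne (ne_of_mem_of_not_mem hj hi)])
    have hint := integrable_exp_sqrt_one_add_norm_sum_sq μ hX hbound
    calc _ ≤ Real.exp (3 * ∫ a, ‖X i a‖ ^ 2 ∂μ i) *
          ∫ w, Real.exp √(1 + ‖∑ j ∈ s, X j (w j)‖ ^ 2) ∂Measure.pi μ :=
          integral_le_mul_integral_of_update μ (hint _) (hint s) i fun w => by
            simp only [hupdate]
            exact integral_exp_sqrt_one_add_norm_sq_add_le (hX i).aestronglyMeasurable (hbound i)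
              (hmean i) _
      _ ≤ Real.exp (3 * ∫ a, ‖X i a‖ ^ 2 ∂μ i) *
          Real.exp (1 + 3 * ∑ j ∈ s, ∫ a, ‖X j a‖ ^ 2 ∂μ j) := by gcongr
      _ = _ := by
          rw [← Real.exp_add, Finset.sum_insert hi]
          ring_nf

theorem integral_exp_norm_sum_le (hX : ∀ i, StronglyMeasurable (X i))
    (hbound : ∀ i a, ‖X i a‖ ≤ 2 / 3) (hmean : ∀ i, ∫ a, X i a ∂μ i = 0) :
    ∫ w, Real.exp ‖∑ i, X i (w i)‖ ∂Measure.pi μ ≤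
      Real.exp (1 + 3 * ∑ i, ∫ a, ‖X i a‖ ^ 2 ∂μ i) :=
  (integral_mono_of_nonneg (ae_of_all _ fun _ => (Real.exp_pos _).le)
    (integrable_exp_sqrt_one_add_norm_sum_sq μ hX hbound Finset.univ)
    (ae_of_all _ fun _ => Real.exp_le_exp.2 (Real.le_sqrt_of_sq_le (by linarith)))).trans
    (integral_exp_sqrt_one_add_norm_sum_sq_le μ hX hbound hmean Finset.univ)

end ExpNorm

section DropoutLaw

theorem isProbabilityMeasure_bitLaw {p : ℝ} (hp0 : 0 ≤ p) (hp1 : p ≤ 1) :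
    IsProbabilityMeasure (bitLaw p) := by
  constructor
  simp [bitLaw, ← ENNReal.ofReal_add hp0 (sub_nonneg.2 hp1)]

theorem isProbabilityMeasure_dropoutLaw (d : ℕ) (h : ℕ → ℕ) {p : ℝ} (hp0 : 0 ≤ p) (hp1 : p ≤ 1) :
    IsProbabilityMeasure (dropoutLaw d h p) := by
  have := isProbabilityMeasure_bitLaw hp0 hp1
  unfold dropoutLaw
  infer_instance

theorem integral_bitLaw {E : Type*} [NormedAddCommGroup E] [NormedSpace ℝ E] [CompleteSpace E]
    {p : ℝ} (hp0 : 0 ≤ p) (hp1 : p ≤ 1) (f : Bool → E) :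
    ∫ b, f b ∂bitLaw p = p • f false + (1 - p) • f true := by
  have := isProbabilityMeasure_bitLaw hp0 hp1
  rw [integral_fintype .of_finite]
  simp [Measure.real, bitLaw, hp0, hp1, add_comm]

theorem integral_multiplier_sub_one {p : ℝ} (hp0 : 0 ≤ p) (hp1 : p < 1) :
    ∫ b, (multiplier p b - 1) ∂bitLaw p = 0 := by
  have : 1 - p ≠ 0 := by linarith
  rw [integral_bitLaw hp0 hp1.le]
  simp only [multiplier, Bool.false_eq_true, if_false, if_true, smul_eq_mul]
  field_simp
  ring

theorem integral_multiplier_sub_one_sq {p : ℝ} (hp0 : 0 ≤ p) (hp1 : p < 1) :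
    ∫ b, (multiplier p b - 1) ^ 2 ∂bitLaw p = p / (1 - p) := by
  have : 1 - p ≠ 0 := by linarith
  rw [integral_bitLaw hp0 hp1.le]
  simp only [multiplier, Bool.false_eq_true, if_false, if_true, smul_eq_mul]
  field_simp
  ring

theorem abs_multiplier_sub_one_le {p : ℝ} (hp0 : 0 ≤ p) (hp1 : p ≤ 3 / 4) (b : Bool) :
    |multiplier p b - 1| ≤ 3 := by
  have hp' : 0 < 1 - p := by linarith
  cases b
  · norm_num [multiplier]
  · have hle : 1 / (1 - p) ≤ 4 := by rw [div_le_iff₀ hp']; linarith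
    have hge : 1 ≤ 1 / (1 - p) := by rw [le_div_iff₀ hp']; linarith
    simp only [multiplier, if_true]
    exact abs_le.2 ⟨by linarith, by linarith⟩

theorem integral_exp_norm_sum_multiplier_le {E : Type*} [NormedAddCommGroup E]
    [InnerProductSpace ℝ E] [CompleteSpace E] {p : ℝ} (hp0 : 0 ≤ p) (hp1 : p ≤ 3 / 4) {n : ℕ}
    {v : Fin n → E} (hv : ∀ j, ‖v j‖ ≤ 2 / 9) :
    ∫ b, Real.exp ‖∑ j, (multiplier p (b j) - 1) • v j‖ ∂Measure.pi (fun _ : Fin n => bitLaw p) ≤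
      Real.exp (1 + 12 * p * ∑ j, ‖v j‖ ^ 2) := by
  have := isProbabilityMeasure_bitLaw hp0 (by linarith : p ≤ 1)
  have hbound : ∀ j b, ‖(multiplier p b - 1) • v j‖ ≤ 2 / 3 := fun j b => by
    rw [norm_smul, Real.norm_eq_abs]
    exact (mul_le_mul (abs_multiplier_sub_one_le hp0 hp1 b) (hv j) (norm_nonneg _)
      zero_le_three).trans_eq (by norm_num)
  have hmean : ∀ j, ∫ b, (multiplier p b - 1) • v j ∂bitLaw p = 0 := fun j => by
    rw [integral_smul_const, integral_multiplier_sub_one hp0 (by linarith), zero_smul]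
  have hvar (j : Fin n) :
      ∫ b, ‖(multiplier p b - 1) • v j‖ ^ 2 ∂bitLaw p ≤ 4 * p * ‖v j‖ ^ 2 := by
    simp only [norm_smul, mul_pow, Real.norm_eq_abs, sq_abs]
    rw [integral_mul_const, integral_multiplier_sub_one_sq hp0 (by linarith)]
    gcongr
    rw [div_le_iff₀ (by linarith)]
    nlinarith
  refine (integral_exp_norm_sum_le (fun _ => bitLaw p) (X := fun j b => (multiplier p b - 1) • v j)
    (fun j => .of_discrete) hbound hmean).trans ?_
  gcongr 2
  calc 3 * ∑ j, ∫ b, ‖(multiplier p b - 1) • v j‖ ^ 2 ∂bitLaw p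
      ≤ 3 * ∑ j, 4 * p * ‖v j‖ ^ 2 := by gcongr with j; exact hvar j
    _ = 12 * p * ∑ j, ‖v j‖ ^ 2 := by rw [← Finset.mul_sum]; ring

theorem pi_bitLaw_real_half_lt_card_kept_le {p : ℝ} (hp0 : 1 / 2 ≤ p) (hp1 : p ≤ 1) (n : ℕ) :
    (Measure.pi fun _ : Fin n => bitLaw p).real
        {b | n / 2 < (Finset.univ.filter fun j => b j = true).card} ≤
      Real.exp (-2 * n * (p - 1 / 2) ^ 2) := by
  have := isProbabilityMeasure_bitLaw (by linarith : 0 ≤ p) hp1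
  set ν := Measure.pi fun _ : Fin n => bitLaw p
  let keep : Bool → ℝ := fun b => if b then 1 else 0
  have hmean : ∀ j, ∫ b : Fin n → Bool, keep (b j) ∂ν = 1 - p := fun j => by
    rw [integral_comp_eval (μ := fun _ : Fin n => bitLaw p) (f := keep) .of_discrete,
      integral_bitLaw (by linarith) hp1]
    simp [keep]
  have hindep : ProbabilityTheory.iIndepFun (fun j (b : Fin n → Bool) => keep (b j) - (1 - p)) ν :=
    ProbabilityTheory.iIndepFun_pi (X := fun _ b => keep b - (1 - p)) fun _ => .of_discrete
  have hsubG : ∀ j ∈ Finset.univ, ProbabilityTheory.HasSubgaussianMGF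
      (fun b : Fin n → Bool => keep (b j) - (1 - p)) ((‖(1 : ℝ) - 0‖₊ / 2) ^ 2) ν := fun j _ => by
    have := ProbabilityTheory.hasSubgaussianMGF_of_mem_Icc (μ := ν) (a := 0) (b := 1)
      (X := fun b => keep (b j)) .of_discrete (ae_of_all _ fun b => by
        cases b j <;> simp [keep])
    rwa [hmean] at this
  have hsum : ∀ b : Fin n → Bool, ∑ j, (keep (b j) - (1 - p)) =
      (Finset.univ.filter fun j => b j = true).card - n * (1 - p) := fun b => by
    simp [keep, Finset.sum_sub_distrib, mul_sub]
  calc ν.real {b | n / 2 < (Finset.univ.filter fun j => b j = true).card}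
      ≤ ν.real {b | n * (p - 1 / 2) ≤ ∑ j, (keep (b j) - (1 - p))} := by
        refine measureReal_mono fun b (hb : n / 2 < _) => ?_
        have hcard : (n : ℝ) ≤ 2 * (Finset.univ.filter fun j => b j = true).card := by
          exact_mod_cast (by omega)
        rw [Set.mem_ofPred_eq, hsum]
        linarith
    _ ≤ Real.exp (-(n * (p - 1 / 2)) ^ 2 /
          (2 * ∑ j : Fin n, ((‖(1 : ℝ) - 0‖₊ / 2) ^ 2 : NNReal))) :=
        ProbabilityTheory.HasSubgaussianMGF.measure_sum_ge_le_of_iIndepFun hindep hsubG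
          (mul_nonneg n.cast_nonneg (by linarith))
    _ = Real.exp (-2 * n * (p - 1 / 2) ^ 2) := by
        rcases Nat.eq_zero_or_pos n with rfl | hn
        · simp
        · have : (n : ℝ) ≠ 0 := by positivity
          simp only [one_div, sub_zero, nnnorm_one, inv_pow, Finset.sum_const, Finset.card_univ,
            Fintype.card_fin, nsmul_eq_mul, NNReal.coe_mul, NNReal.coe_natCast, NNReal.coe_inv,
            NNReal.coe_pow, NNReal.coe_ofNat, neg_mul, Real.exp_eq_exp]
          field_simp

theorem dropoutLaw_real_half_lt_card_kept_le {p : ℝ} (hp0 : 1 / 2 ≤ p) (hp1 : p ≤ 1) {d : ℕ}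
    {h : ℕ → ℕ} (i : Fin (d - 1)) :
    (dropoutLaw d h p).real
        {w | h (i + 1) / 2 < (Finset.univ.filter fun j => w i j = true).card} ≤
      Real.exp (-2 * h (i + 1) * (p - 1 / 2) ^ 2) := by
  have := isProbabilityMeasure_bitLaw (by linarith : 0 ≤ p) hp1
  have heval := measurePreserving_eval
    (fun i : Fin (d - 1) => Measure.pi fun _ : Fin (h (i + 1)) => bitLaw p) i
  have hle := pi_bitLaw_real_half_lt_card_kept_le hp0 hp1 (h (i + 1))
  rwa [← heval.measureReal_preimage (Set.toFinite _).measurableSet.nullMeasurableSet] at hle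

end DropoutLaw

section LinearAlgebra

variable {m n : ℕ} (A : Matrix (Fin m) (Fin n) ℝ)

theorem norm_toEuclideanLin_le (v : Vec n) : ‖Matrix.toEuclideanLin A v‖ ≤ ‖A‖ * ‖v‖ :=
  Matrix.l2_opNorm_mulVec A v

theorem toEuclideanLin_scaleColumns (s : Fin n → ℝ) (v : Vec n) :
    Matrix.toEuclideanLin (scaleColumns A s) v = ∑ j, s j • v j • column A j := by
  ext r
  simp [Matrix.toLpLin_apply, Matrix.mulVec, dotProduct, column, scaleColumns, mul_comm,
    mul_left_comm, mul_assoc]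

theorem norm_scaleColumns_le {s : Fin n → ℝ} {b : ℝ} (hb : 0 ≤ b) (hs : ∀ j, |s j| ≤ b) :
    ‖scaleColumns A s‖ ≤ ‖A‖ * b := by
  have hmul : scaleColumns A s = A * Matrix.diagonal s := by
    ext r j
    simp [scaleColumns, mul_comm]
  rw [hmul]
  refine (Matrix.l2_opNorm_mul _ _).trans ?_
  rw [Matrix.l2_opNorm_diagonal]
  gcongr
  exact (pi_norm_le_iff_of_nonneg hb).2 hs

theorem frob_nonneg : 0 ≤ frob A := Real.sqrt_nonneg _

theorem frob_sq : frob A ^ 2 = ∑ j, ‖column A j‖ ^ 2 := by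
  rw [frob, Real.sq_sqrt (by positivity), Finset.sum_comm]
  simp [EuclideanSpace.norm_sq_eq, column]

variable {A}

theorem frob_pos (hA : A ≠ 0) : 0 < frob A := by
  obtain ⟨r, j, hrj⟩ : ∃ r j, A r j ≠ 0 := by
    by_contra! hzero
    exact hA (Matrix.ext hzero)
  exact Real.sqrt_pos.2 (Finset.sum_pos' (fun _ _ => by positivity) ⟨r, Finset.mem_univ r,
    Finset.sum_pos' (fun _ _ => by positivity) ⟨j, Finset.mem_univ j, by positivity⟩⟩)

theorem one_le_card_mul_sq_of_norm_column_le {b : ℝ} (hA : A ≠ 0)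
    (hb : ∀ j, ‖column A j‖ ≤ b * frob A) : 1 ≤ n * b ^ 2 := by
  refine le_of_mul_le_mul_right ?_ (pow_pos (frob_pos hA) 2)
  calc 1 * frob A ^ 2 = ∑ j, ‖column A j‖ ^ 2 := by rw [one_mul, frob_sq]
    _ ≤ ∑ _j : Fin n, (b * frob A) ^ 2 :=
      Finset.sum_le_sum fun j _ => pow_le_pow_left₀ (norm_nonneg _) (hb j) 2
    _ = n * b ^ 2 * frob A ^ 2 := by
      rw [Finset.sum_const, Finset.card_univ, Fintype.card_fin, nsmul_eq_mul, mul_pow, mul_assoc]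

end LinearAlgebra

section Activation

variable {n : ℕ} {h : ℕ → ℕ} (i : ℕ)

theorem relu_zero : relu (0 : Vec n) = 0 := by
  ext k
  simp [relu]

theorem norm_relu_sub_le (v w : Vec n) : ‖relu v - relu w‖ ≤ ‖v - w‖ := by
  rw [EuclideanSpace.norm_eq, EuclideanSpace.norm_eq]
  refine Real.sqrt_le_sqrt (Finset.sum_le_sum fun k _ => ?_)
  have : |max (v k) 0 - max (w k) 0| ≤ |v k - w k| := abs_max_sub_max_le_abs _ _ _
  simpa [relu] using pow_le_pow_left₀ (abs_nonneg _) this 2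

theorem norm_relu_le (v : Vec n) : ‖relu v‖ ≤ ‖v‖ := by
  simpa [relu_zero] using norm_relu_sub_le v 0

theorem act_zero : act i (0 : Vec (h i)) = 0 := by
  cases i with
  | zero => rfl
  | succ i => exact relu_zero

theorem norm_act_sub_le (v w : Vec (h i)) : ‖act i v - act i w‖ ≤ ‖v - w‖ := by
  cases i with
  | zero => exact le_rfl
  | succ i => exact norm_relu_sub_le v w

theorem norm_act_le (v : Vec (h i)) : ‖act i v‖ ≤ ‖v‖ := by
  simpa [act_zero] using norm_act_sub_le i v 0

theorem toEuclideanLin_diagonal_actDeriv (v : Vec (h i)) :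
    Matrix.toEuclideanLin (Matrix.diagonal (actDeriv i v)) v = act i v := by
  ext k
  rw [Matrix.toLpLin_apply]
  simp only [Matrix.mulVec_diagonal]
  cases i with
  | zero => simp [act, actDeriv]
  | succ i =>
    simp only [act, actDeriv, relu]
    split_ifs with hv
    · simp [hv.le]
    · simp [not_lt.1 hv]

end Activation

section Layers

variable {h : ℕ → ℕ} {θ θ' : Params h}

theorem toEuclideanLin_jacobian (θ : Params h) (i k : ℕ) (v : Vec (h i)) :
    Matrix.toEuclideanLin (jacobian θ i k v) v = layerMap θ i k v := by
  induction k with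
  | zero => simp [jacobian, layerMap]
  | succ k ih =>
    simp only [jacobian, Matrix.toLpLin_mul_same, LinearMap.comp_apply]
    rw [ih, toEuclideanLin_diagonal_actDeriv]
    rfl

theorem layerMap_preact (θ : Params h) (x : Vec (h 0)) (i k : ℕ) :
    layerMap θ i k (preact θ x i) = preact θ x (i + k) := by
  induction k with
  | zero => rfl
  | succ k ih =>
    rw [layerMap, ih]
    rfl

theorem layerMap_zero (θ : Params h) (i k : ℕ) : layerMap θ i k 0 = 0 := by
  induction k with
  | zero => rfl
  | succ k ih => rw [layerMap, ih, step, act_zero, map_zero]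

theorem layerMap_congr {i : ℕ} (hθ : ∀ j, i ≤ j → θ j = θ' j) (k : ℕ) (v : Vec (h i)) :
    layerMap θ i k v = layerMap θ' i k v := by
  induction k with
  | zero => rfl
  | succ k ih => rw [layerMap, layerMap, ih, step, step, hθ _ (by omega)]

theorem preact_congr (x : Vec (h 0)) {j : ℕ} (hθ : ∀ i, i < j → θ i = θ' i) :
    preact θ x j = preact θ' x j := by
  induction j with
  | zero => rfl
  | succ j ih => rw [preact, preact, ih fun i hi => hθ i (by omega), step, step, hθ j (by omega)]

end Layers

section Dropout

variable {d : ℕ} {h : ℕ → ℕ} {p : ℝ} {w : Mask d h} {θ : Params h}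

theorem dropUpTo_of_le {n i : ℕ} (hn : n ≤ i) : dropUpTo p w θ n i = θ i := by
  cases i with
  | zero => rfl
  | succ i => simp [dropUpTo, show ¬ i + 2 ≤ n by omega]

theorem dropUpTo_one : dropUpTo p w θ 1 = θ := by
  funext i
  cases i with
  | zero => rfl
  | succ i => exact dropUpTo_of_le (by omega)

theorem dropUpTo_eq_of_lt {n n' i : ℕ} (hn : i < n) (hn' : i < n') :
    dropUpTo p w θ n i = dropUpTo p w θ n' i := by
  cases i with
  | zero => rfl
  | succ i => simp [dropUpTo, show i + 2 ≤ n by omega, show i + 2 ≤ n' by omega]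

theorem dropUpTo_update {m : Fin (d - 1)} (a : Fin (h (m + 1)) → Bool) {n : ℕ} (hn : n < m + 2) :
    dropUpTo p (Function.update w m a) θ n = dropUpTo p w θ n := by
  funext i
  cases i with
  | zero => rfl
  | succ i =>
    simp only [dropUpTo]
    split_ifs with hi hin
    · rw [Function.update_of_ne]
      rintro rfl
      simp only at hn
      omega
    all_goals rfl

theorem onSegment_apply (θ θ' : Params h) (t : ℝ) (i : ℕ) :
    onSegment θ θ' t i = θ i + t • (θ' i - θ i) := rfl

theorem onSegment_self (θ : Params h) (t : ℝ) : onSegment θ θ t = θ := by simp [onSegment]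

/-- The preactivation `x̂^i_n(t)` at layer `i` of the network `tθ^n + (1 - t)θ`, where `θ^n` is `θ`
with dropout applied to the weight matrices of layers `2, …, n`. -/
noncomputable def noisyPreact (p : ℝ) (w : Mask d h) (θ : Params h) (n : ℕ) (t : ℝ)
    (x : Vec (h 0)) (i : ℕ) : Vec (h i) :=
  preact (onSegment θ (dropUpTo p w θ n) t) x i

/-- The noise `(Â - A) v` produced by applying the dropout outcome `b` to the columns of `A`. -/
noncomputable def dropoutNoise {m n : ℕ} (p : ℝ) (A : Matrix (Fin m) (Fin n) ℝ)
    (b : Fin n → Bool) (v : Vec n) : Vec m :=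
  Matrix.toEuclideanLin (scaleColumns A fun j => multiplier p (b j) - 1) v

theorem noisyPreact_one (t : ℝ) (x : Vec (h 0)) (i : ℕ) :
    noisyPreact p w θ 1 t x i = preact θ x i := by
  rw [noisyPreact, dropUpTo_one, onSegment_self]

theorem noisyPreact_update {m : Fin (d - 1)} (a : Fin (h (m + 1)) → Bool) {n : ℕ} (hn : n < m + 2)
    (t : ℝ) (x : Vec (h 0)) (i : ℕ) :
    noisyPreact p (Function.update w m a) θ n t x i = noisyPreact p w θ n t x i := by
  rw [noisyPreact, dropUpTo_update a hn, noisyPreact]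

theorem noisyPreact_eq_layerMap {n i : ℕ} (hn : n ≤ i) (t : ℝ) (x : Vec (h 0)) (k : ℕ) :
    noisyPreact p w θ n t x (i + k) = layerMap θ i k (noisyPreact p w θ n t x i) := by
  rw [noisyPreact, ← layerMap_preact]
  refine layerMap_congr (fun j hj => ?_) _ _
  rw [onSegment_apply, dropUpTo_of_le (hn.trans hj), sub_self, smul_zero, add_zero]

theorem noisyPreact_sub_noisyPreact (m : Fin (d - 1)) (t : ℝ) (x : Vec (h 0)) :
    noisyPreact p w θ (m + 2) t x (m + 2) - noisyPreact p w θ (m + 1) t x (m + 2) =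
      t • dropoutNoise p (θ (m + 1)) (w m) (relu (noisyPreact p w θ (m + 1) t x (m + 1))) := by
  have hbelow : noisyPreact p w θ (m + 2) t x (m + 1) = noisyPreact p w θ (m + 1) t x (m + 1) :=
    preact_congr x fun i hi => by
      rw [onSegment_apply, onSegment_apply, dropUpTo_eq_of_lt (n' := m + 1) (by omega) hi]
  have hnoise : dropUpTo p w θ (m + 2) (m + 1) - θ (m + 1) =
      scaleColumns (θ (m + 1)) fun j => multiplier p (w m j) - 1 := by
    ext r j
    simp [dropUpTo, scaleColumns, sub_mul]
  change step _ (m + 1) (noisyPreact p w θ (m + 2) t x (m + 1)) -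
    step _ (m + 1) (noisyPreact p w θ (m + 1) t x (m + 1)) = _
  rw [hbelow, step, step, onSegment_apply, onSegment_apply, dropUpTo_of_le (n := m + 1) le_rfl,
    sub_self, smul_zero, add_zero, hnoise, map_add, map_smul, LinearMap.add_apply,
    LinearMap.smul_apply, add_sub_cancel_left]
  rfl

end Dropout

section Cushions

variable {d : ℕ} {h : ℕ → ℕ} {S : Sample d h} {θ : Params h}

theorem preact_ne_zero {x : Vec (h 0)} (hx : output d θ x ≠ 0) {i : ℕ} (hi : i ≤ d) :
    preact θ x i ≠ 0 := by
  obtain ⟨k, rfl⟩ := Nat.exists_eq_add_of_le hi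
  intro h0
  exact hx (by rw [output, ← layerMap_preact, h0, layerMap_zero])

theorem act_preact_ne_zero {x : Vec (h 0)} (hx : output d θ x ≠ 0) {i : ℕ} (hi : i < d) :
    act i (preact θ x i) ≠ 0 := fun h0 =>
  preact_ne_zero hx (i := i + 1) hi (by rw [preact, step, h0, map_zero])

theorem weight_ne_zero {x : Vec (h 0)} (hx : output d θ x ≠ 0) {i : ℕ} (hi : i < d) :
    θ i ≠ 0 := fun h0 =>
  preact_ne_zero hx (i := i + 1) hi (by rw [preact, step, h0, map_zero, LinearMap.zero_apply])

theorem layerCushion_mul_le {z : Vec (h 0) × Vec (h d)} (hz : z ∈ S) (i : ℕ) :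
    layerCushion S θ i * (frob (θ i) * ‖act i (preact θ z.1 i)‖) ≤ ‖preact θ z.1 (i + 1)‖ :=
  mul_le_of_le_div₀ (norm_nonneg _) (mul_nonneg (frob_nonneg _) (norm_nonneg _))
    (ciInf_le (Finite.bddBelow_range _) (⟨z, hz⟩ : S))

theorem minInterlayerCushion_le {z : Vec (h 0) × Vec (h d)} (hz : z ∈ S) {i k : ℕ}
    (hik : i + k ≤ d) :
    minInterlayerCushion S θ i ≤
      ‖Matrix.toEuclideanLin (jacobian θ i k (preact θ z.1 i)) (preact θ z.1 i)‖ /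
        (‖jacobian θ i k (preact θ z.1 i)‖ * ‖preact θ z.1 i‖) :=
  (ciInf_le (Finite.bddBelow_range _) (⟨k, by omega⟩ : Fin (d - i + 1))).trans
    (ciInf_le (Finite.bddBelow_range _) (⟨z, hz⟩ : S))

theorem minInterlayerCushion_mul_le {z : Vec (h 0) × Vec (h d)} (hz : z ∈ S) {i k : ℕ}
    (hik : i + k ≤ d) :
    minInterlayerCushion S θ i * (‖jacobian θ i k (preact θ z.1 i)‖ * ‖preact θ z.1 i‖) ≤
      ‖preact θ z.1 (i + k)‖ := by
  have := mul_le_of_le_div₀ (norm_nonneg _) (by positivity)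
    (minInterlayerCushion_le (θ := θ) hz hik)
  rwa [toEuclideanLin_jacobian, layerMap_preact] at this

theorem minInterlayerCushion_le_one (hS : S.Nonempty) {i : ℕ} (hi : i ≤ d) :
    minInterlayerCushion S θ i ≤ 1 := by
  obtain ⟨z, hz⟩ := hS
  exact (minInterlayerCushion_le hz (k := 0) hi).trans
    (div_le_one_of_le₀ (norm_toEuclideanLin_le _ _) (by positivity))

theorem minCushion_le (m : Fin (d - 1)) :
    minCushion S θ ≤ layerCushion S θ (m + 1) * minInterlayerCushion S θ (m + 2) :=
  ciInf_le (Finite.bddBelow_range _) m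

theorem ciInf_pos_of_finite {ι : Type*} [Finite ι] [Nonempty ι] {f : ι → ℝ} (hf : ∀ i, 0 < f i) :
    0 < ⨅ i, f i := by
  obtain ⟨i, hi⟩ := exists_eq_ciInf_of_finite (f := f)
  exact hi ▸ hf i

theorem norm_preact_le_activationContraction_mul (hout : ∀ z ∈ S, output d θ z.1 ≠ 0)
    {z : Vec (h 0) × Vec (h d)} (hz : z ∈ S) (m : Fin (d - 1)) :
    ‖preact θ z.1 (m + 1)‖ ≤ activationContraction S θ * ‖relu (preact θ z.1 (m + 1))‖ := by
  have hrelu : 0 < ‖relu (preact θ z.1 (m + 1))‖ :=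
    norm_pos_iff.2 (act_preact_ne_zero (hout z hz) (i := m + 1) (by omega))
  rw [← div_le_iff₀ hrelu]
  exact (le_ciSup (f := fun m : Fin (d - 1) => ‖preact θ z.1 (m + 1)‖ /
    ‖relu (preact θ z.1 (m + 1))‖) (Finite.bddAbove_range _) m).trans
    (le_ciSup (f := fun z : S => ⨆ i : Fin (d - 1), ‖preact θ z.1.1 (i + 1)‖ /
      ‖relu (preact θ z.1.1 (i + 1))‖) (Finite.bddAbove_range _) ⟨z, hz⟩)

section Positivity

variable (hS : S.Nonempty) (hout : ∀ z ∈ S, output d θ z.1 ≠ 0)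
include hS hout

theorem layerCushion_pos {i : ℕ} (hi : i < d) : 0 < layerCushion S θ i := by
  have : Nonempty S := hS.to_subtype
  refine ciInf_pos_of_finite fun z => ?_
  have hx := hout z.1 z.2
  exact div_pos (norm_pos_iff.2 (preact_ne_zero hx (i := i + 1) hi))
    (mul_pos (frob_pos (weight_ne_zero hx hi)) (norm_pos_iff.2 (act_preact_ne_zero hx hi)))

theorem minInterlayerCushion_pos {i : ℕ} (hi : i ≤ d) : 0 < minInterlayerCushion S θ i := by
  have : Nonempty S := hS.to_subtype
  refine ciInf_pos_of_finite fun k => ciInf_pos_of_finite fun z => ?_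
  have himage : 0 < ‖Matrix.toEuclideanLin (jacobian θ i k (preact θ z.1.1 i))
      (preact θ z.1.1 i)‖ := by
    rw [toEuclideanLin_jacobian, layerMap_preact]
    exact norm_pos_iff.2 (preact_ne_zero (hout z.1 z.2) (by omega))
  exact div_pos himage (himage.trans_le (norm_toEuclideanLin_le _ _))

theorem minCushion_pos (hd : 2 ≤ d) : 0 < minCushion S θ := by
  have : Nonempty (Fin (d - 1)) := ⟨⟨0, by omega⟩⟩
  exact ciInf_pos_of_finite fun m => mul_pos (layerCushion_pos hS hout (by omega))
    (minInterlayerCushion_pos hS hout (by omega))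

theorem activationContraction_pos (hd : 2 ≤ d) : 0 < activationContraction S θ := by
  obtain ⟨z, hz⟩ := hS
  have hle := norm_preact_le_activationContraction_mul hout hz ⟨0, by omega⟩
  have hpos : 0 < ‖preact θ z.1 (0 + 1)‖ :=
    norm_pos_iff.2 (preact_ne_zero (hout z hz) (by omega))
  exact pos_of_mul_pos_left (hpos.trans_le hle) (norm_nonneg _)

end Positivity

end Cushions

section Perturbation

theorem norm_sub_le_of_norm_sub_linear_le {E F : Type*} [NormedAddCommGroup E] [Module ℝ E]
    [SeminormedAddCommGroup F] [Module ℝ F] {M : E → F} {J : E →ₗ[ℝ] F} {v v' x : E} {y : F}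
    {ρ a q : ℝ} (hρ : 0 < ρ) (hx : x ≠ 0)
    (hv : ‖M v - J v‖ ≤ ‖v - x‖ * ‖y‖ / (ρ * ‖x‖))
    (hv' : ‖M v' - J v'‖ ≤ ‖v' - x‖ * ‖y‖ / (ρ * ‖x‖))
    (hvv' : ‖v - v'‖ ≤ a * ‖x‖) (hJ : ‖J (v - v')‖ ≤ a * ‖y‖)
    (hv'x : ‖v' - x‖ ≤ q * ‖x‖) (hMv' : ‖M v' - y‖ ≤ q * ‖y‖) :
    ‖M v - y‖ ≤ (q + a + (a + 2 * q) / ρ) * ‖y‖ := by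
  have : 0 < ‖x‖ := norm_pos_iff.2 hx
  have hvx : ‖v - x‖ ≤ (a + q) * ‖x‖ := by
    linarith [norm_sub_le_norm_sub_add_norm_sub v v' x]
  have linearize {u : E} {b : ℝ} (hu : ‖M u - J u‖ ≤ ‖u - x‖ * ‖y‖ / (ρ * ‖x‖))
      (hux : ‖u - x‖ ≤ b * ‖x‖) : ‖M u - J u‖ ≤ b / ρ * ‖y‖ :=
    calc ‖M u - J u‖ ≤ b * ‖x‖ * ‖y‖ / (ρ * ‖x‖) := hu.trans (by gcongr)
      _ = b / ρ * ‖y‖ := by field_simp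
  have hsplit : M v - y = (M v - J v) - (M v' - J v') + J (v - v') + (M v' - y) := by
    rw [map_sub]
    abel
  calc ‖M v - y‖ ≤ ‖M v - J v‖ + ‖M v' - J v'‖ + ‖J (v - v')‖ + ‖M v' - y‖ := by
        rw [hsplit]
        exact (norm_add₃_le ..).trans (by gcongr; exact norm_sub_le _ _)
    _ ≤ (a + q) / ρ * ‖y‖ + q / ρ * ‖y‖ + a * ‖y‖ + q * ‖y‖ := by
        gcongr
        · exact linearize hv hvx
        · exact linearize hv' hv'x
    _ = (q + a + (a + 2 * q) / ρ) * ‖y‖ := by ring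

theorem mul_exp_recurrence_le {A α r δ : ℝ} (hA : 0 ≤ A) (hα : 0 ≤ α) (hr : 0 ≤ r) (hδ : 0 ≤ δ) :
    A * Real.exp (A + r) * (1 + α + δ) + α ≤
      (A + α) * Real.exp (A + α + (r + δ)) := by
  have hgrowth : 1 + α + δ ≤ Real.exp (α + δ) := by linarith [Real.add_one_le_exp (α + δ)]
  have hone : 1 ≤ Real.exp (A + α + (r + δ)) := Real.one_le_exp (by positivity)
  calc A * Real.exp (A + r) * (1 + α + δ) + α
      ≤ A * Real.exp (A + r) * Real.exp (α + δ) + α * Real.exp (A + α + (r + δ)) := by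
        gcongr
        exact le_mul_of_one_le_right hα hone
    _ = (A + α) * Real.exp (A + α + (r + δ)) := by
        rw [mul_assoc, ← Real.exp_add, show A + r + (α + δ) = A + α + (r + δ) by ring]
        ring

end Perturbation

section Propagation

variable {d : ℕ} {h : ℕ → ℕ} {S : Sample d h} {θ : Params h} {p ρ t : ℝ} {w : Mask d h}
  {z : Vec (h 0) × Vec (h d)}

/-- The factor `c / min_{2 ≤ i ≤ d} μ_i μ_{i→}` by which noise injected at a layer, measured
relative to the Frobenius norm of its weight matrix, is amplified at any later layer. -/
noncomputable def noiseGain (S : Sample d h) (θ : Params h) : ℝ :=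
  activationContraction S θ / minCushion S θ

variable (hd : 2 ≤ d) (hS : S.Nonempty) (hout : ∀ z ∈ S, output d θ z.1 ≠ 0)
include hd hS hout

theorem noiseGain_pos : 0 < noiseGain S θ :=
  div_pos (activationContraction_pos hS hout hd) (minCushion_pos hS hout hd)

theorem frob_mul_norm_preact_le (hz : z ∈ S) (m : Fin (d - 1)) :
    frob (θ (m + 1)) * ‖preact θ z.1 (m + 1)‖ ≤
      minInterlayerCushion S θ (m + 2) * (noiseGain S θ * ‖preact θ z.1 (m + 2)‖) := by
  have hcushion := minCushion_pos hS hout hd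
  have hcontraction := activationContraction_pos hS hout hd
  have hinterlayer := minInterlayerCushion_pos hS hout (i := m + 2) (by omega)
  have hfrob := frob_nonneg (θ (m + 1))
  rw [noiseGain, div_mul_eq_mul_div, mul_div_assoc', le_div_iff₀' hcushion]
  calc minCushion S θ * (frob (θ (m + 1)) * ‖preact θ z.1 (m + 1)‖)
      ≤ layerCushion S θ (m + 1) * minInterlayerCushion S θ (m + 2) * (frob (θ (m + 1)) *
          (activationContraction S θ * ‖relu (preact θ z.1 (m + 1))‖)) := by
        gcongr
        · exact hcushion.le.trans (minCushion_le m)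
        · exact minCushion_le m
        · exact norm_preact_le_activationContraction_mul hout hz m
    _ = minInterlayerCushion S θ (m + 2) * (activationContraction S θ *
          (layerCushion S θ (m + 1) *
            (frob (θ (m + 1)) * ‖relu (preact θ z.1 (m + 1))‖))) := by ring
    _ ≤ _ := by
        gcongr
        exact layerCushion_mul_le hz (m + 1)

variable (hz : z ∈ S) (ht : t ∈ Set.Icc (0 : ℝ) 1)
include hz ht

theorem norm_noisyPreact_sub_noisyPreact_le (m : Fin (d - 1)) {η q : ℝ} (hη : 0 ≤ η) (hq : 0 ≤ q)
    (hnoise : ‖dropoutNoise p (θ (m + 1)) (w m) (relu (noisyPreact p w θ (m + 1) t z.1 (m + 1)))‖ ≤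
      η * (frob (θ (m + 1)) * ‖relu (noisyPreact p w θ (m + 1) t z.1 (m + 1))‖))
    (hbelow : ‖noisyPreact p w θ (m + 1) t z.1 (m + 1) - preact θ z.1 (m + 1)‖ ≤
      q * ‖preact θ z.1 (m + 1)‖) :
    ‖noisyPreact p w θ (m + 2) t z.1 (m + 2) - noisyPreact p w θ (m + 1) t z.1 (m + 2)‖ ≤
      minInterlayerCushion S θ (m + 2) *
        (noiseGain S θ * η * (1 + q) * ‖preact θ z.1 (m + 2)‖) := by
  set y := noisyPreact p w θ (m + 1) t z.1 (m + 1)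
  have hfrob := frob_nonneg (θ (m + 1))
  have hy : ‖relu y‖ ≤ (1 + q) * ‖preact θ z.1 (m + 1)‖ := by
    linarith [norm_relu_le y, norm_le_norm_add_norm_sub' y (preact θ z.1 (m + 1))]
  rw [noisyPreact_sub_noisyPreact, norm_smul, Real.norm_of_nonneg ht.1]
  calc t * ‖dropoutNoise p (θ (m + 1)) (w m) (relu y)‖
      ≤ ‖dropoutNoise p (θ (m + 1)) (w m) (relu y)‖ :=
        mul_le_of_le_one_left (norm_nonneg _) ht.2
    _ ≤ η * (frob (θ (m + 1)) * ((1 + q) * ‖preact θ z.1 (m + 1)‖)) := hnoise.trans (by gcongr)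
    _ = η * (1 + q) * (frob (θ (m + 1)) * ‖preact θ z.1 (m + 1)‖) := by ring
    _ ≤ η * (1 + q) * (minInterlayerCushion S θ (m + 2) *
          (noiseGain S θ * ‖preact θ z.1 (m + 2)‖)) := by
        exact mul_le_mul_of_nonneg_left (frob_mul_norm_preact_le hd hS hout hz m) (by positivity)
    _ = _ := by ring

variable (hρ : 3 * (d : ℝ) ≤ ρ) (hsmooth : SmoothFor S θ p ρ w)
include hρ hsmooth

theorem norm_noisyPreact_succ_sub_preact_le (m : Fin (d - 1)) {η q : ℝ} (hη : 0 ≤ η) (hq : 0 ≤ q)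
    (hnoise : ‖dropoutNoise p (θ (m + 1)) (w m) (relu (noisyPreact p w θ (m + 1) t z.1 (m + 1)))‖ ≤
      η * (frob (θ (m + 1)) * ‖relu (noisyPreact p w θ (m + 1) t z.1 (m + 1))‖))
    (herror : ∀ j : ℕ, (m : ℕ) + 1 ≤ j → j ≤ d →
      ‖noisyPreact p w θ (m + 1) t z.1 j - preact θ z.1 j‖ ≤ q * ‖preact θ z.1 j‖)
    {j : ℕ} (hmj : (m : ℕ) + 2 ≤ j) (hjd : j ≤ d) :
    ‖noisyPreact p w θ (m + 2) t z.1 j - preact θ z.1 j‖ ≤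
      (q * (1 + 2 * (noiseGain S θ * η) + 1 / d) + 2 * (noiseGain S θ * η)) *
        ‖preact θ z.1 j‖ := by
  obtain ⟨k, rfl⟩ := Nat.exists_eq_add_of_le hmj
  have hd2 : (2 : ℝ) ≤ d := by exact_mod_cast hd
  set a := noiseGain S θ * η * (1 + q)
  have ha0 : 0 ≤ a := mul_nonneg (mul_nonneg (noiseGain_pos hd hS hout).le hη) (by positivity)
  have hdiff := norm_noisyPreact_sub_noisyPreact_le hd hS hout hz ht m hη hq hnoise
    (herror _ le_rfl (by omega))
  have hdiff' := hdiff.trans (mul_le_of_le_one_left (by positivity)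
    (minInterlayerCushion_le_one hS (by omega)))
  have hlinear : ‖Matrix.toEuclideanLin (jacobian θ (m + 2) k (preact θ z.1 (m + 2)))
      (noisyPreact p w θ (m + 2) t z.1 (m + 2) - noisyPreact p w θ (m + 1) t z.1 (m + 2))‖ ≤
      a * ‖preact θ z.1 (m + 2 + k)‖ := by
    refine (norm_toEuclideanLin_le _ _).trans ((mul_le_mul_of_nonneg_left hdiff
      (norm_nonneg _)).trans ?_)
    linarith [mul_le_mul_of_nonneg_left (minInterlayerCushion_mul_le (θ := θ) hz hjd) ha0]
  have hnext := herror (m + 2 + k) (by omega) hjd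
  rw [noisyPreact_eq_layerMap (by omega)] at hnext ⊢
  refine (norm_sub_le_of_norm_sub_linear_le (by linarith)
    (preact_ne_zero (hout z hz) (i := m + 2) (by omega))
    (hsmooth z hz (m + 2) k (by omega) hjd (m + 2) (.inl rfl) t ht)
    (hsmooth z hz (m + 2) k (by omega) hjd (m + 1) (.inr rfl) t ht) hdiff' hlinear
    (herror _ (by omega) (by omega)) hnext).trans ?_
  refine mul_le_mul_of_nonneg_right ?_ (norm_nonneg _)
  have hρa : a / ρ ≤ a := div_le_self ha0 (by linarith)
  have hρq : 2 * q / ρ ≤ q * (1 / d) := by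
    rw [mul_one_div, div_le_div_iff₀ (by linarith) (by linarith)]
    linarith [mul_le_mul_of_nonneg_left hρ hq, mul_nonneg hq (Nat.cast_nonneg (α := ℝ) d)]
  rw [add_div]
  linarith

theorem norm_noisyPreact_sub_preact_le {η : ℕ → ℝ} (hη : ∀ m, 0 ≤ η m)
    (hnoise : ∀ m : Fin (d - 1),
      ‖dropoutNoise p (θ (m + 1)) (w m) (relu (noisyPreact p w θ (m + 1) t z.1 (m + 1)))‖ ≤
        η m * (frob (θ (m + 1)) * ‖relu (noisyPreact p w θ (m + 1) t z.1 (m + 1))‖))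
    (m : ℕ) (hm : m + 1 ≤ d) {j : ℕ} (hmj : m + 1 ≤ j) (hjd : j ≤ d) :
    ‖noisyPreact p w θ (m + 1) t z.1 j - preact θ z.1 j‖ ≤
      (∑ i ∈ Finset.range m, 2 * (noiseGain S θ * η i)) *
        Real.exp ((∑ i ∈ Finset.range m, 2 * (noiseGain S θ * η i)) + m / d) *
          ‖preact θ z.1 j‖ := by
  have hterm (i : ℕ) : 0 ≤ 2 * (noiseGain S θ * η i) :=
    mul_nonneg two_pos.le (mul_nonneg (noiseGain_pos hd hS hout).le (hη i))
  induction m generalizing j with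
  | zero => simp [noisyPreact_one]
  | succ m ih =>
    have hsum : 0 ≤ ∑ i ∈ Finset.range m, 2 * (noiseGain S θ * η i) :=
      Finset.sum_nonneg fun i _ => hterm i
    refine (norm_noisyPreact_succ_sub_preact_le hd hS hout hz ht hρ hsmooth ⟨m, by omega⟩ (hη m)
      (by positivity) (hnoise ⟨m, by omega⟩) (fun j h1 h2 => ih (by omega) h1 h2)
      hmj hjd).trans ?_
    gcongr
    rw [Finset.sum_range_succ, Nat.cast_add_one, add_div]
    exact mul_exp_recurrence_le hsum (hterm m) (by positivity) (by positivity)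

end Propagation

section Lipschitz

variable {h : ℕ → ℕ} {θ θ' : Params h} {G : ℝ} {j : ℕ}

theorem norm_preact_le (x : Vec (h 0)) (hθ : ∀ i < j, ‖θ i‖ ≤ G) :
    ‖preact θ x j‖ ≤ G ^ j * ‖x‖ := by
  induction j with
  | zero => simp [preact]
  | succ j ih =>
    have hG : 0 ≤ G := (norm_nonneg _).trans (hθ j j.lt_succ_self)
    calc ‖preact θ x (j + 1)‖ ≤ ‖θ j‖ * ‖act j (preact θ x j)‖ := norm_toEuclideanLin_le _ _
      _ ≤ G * (G ^ j * ‖x‖) := by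
        gcongr
        · exact hθ j j.lt_succ_self
        · exact (norm_act_le _ _).trans (ih fun i hi => hθ i (by omega))
      _ = G ^ (j + 1) * ‖x‖ := by ring

theorem norm_preact_sub_preact_le (x : Vec (h 0)) {δ : ℝ} (hθ : ∀ i < j, ‖θ i‖ ≤ G)
    (hθ' : ∀ i < j, ‖θ' i‖ ≤ G) (hsub : ∀ i < j, ‖θ i - θ' i‖ ≤ G * δ) :
    ‖preact θ x j - preact θ' x j‖ ≤ j * G ^ j * ‖x‖ * δ := by
  induction j with
  | zero => simp [preact]
  | succ j ih =>
    have hG : 0 ≤ G := (norm_nonneg _).trans (hθ j j.lt_succ_self)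
    set u := act j (preact θ x j)
    set v := act j (preact θ' x j)
    have huv : ‖u - v‖ ≤ j * G ^ j * ‖x‖ * δ := (norm_act_sub_le _ _ _).trans
      (ih (fun i hi => hθ i (by omega)) (fun i hi => hθ' i (by omega))
        fun i hi => hsub i (by omega))
    have hv : ‖v‖ ≤ G ^ j * ‖x‖ :=
      (norm_act_le _ _).trans (norm_preact_le x fun i hi => hθ' i (by omega))
    have hsplit : preact θ x (j + 1) - preact θ' x (j + 1) =
        Matrix.toEuclideanLin (θ j) (u - v) + Matrix.toEuclideanLin (θ j - θ' j) v := by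
      rw [map_sub, map_sub, LinearMap.sub_apply, sub_add_sub_cancel]
      rfl
    calc ‖preact θ x (j + 1) - preact θ' x (j + 1)‖
        ≤ ‖θ j‖ * ‖u - v‖ + ‖θ j - θ' j‖ * ‖v‖ := by
          rw [hsplit]
          exact (norm_add_le _ _).trans
            (add_le_add (norm_toEuclideanLin_le _ _) (norm_toEuclideanLin_le _ _))
      _ ≤ G * (j * G ^ j * ‖x‖ * δ) + G * δ * (G ^ j * ‖x‖) := by
          gcongr
          · exact hθ j j.lt_succ_self
          · exact (norm_nonneg _).trans (hsub j j.lt_succ_self)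
          · exact hsub j j.lt_succ_self
      _ = (j + 1 : ℕ) * G ^ (j + 1) * ‖x‖ * δ := by
          push_cast
          ring

end Lipschitz

section DropoutSegment

variable {d : ℕ} {h : ℕ → ℕ} {p : ℝ} {w : Mask d h} {θ : Params h} (hp0 : 0 ≤ p) (hp1 : p ≤ 3 / 4)
include hp0 hp1

theorem norm_dropUpTo_sub_le (n i : ℕ) : ‖dropUpTo p w θ n i - θ i‖ ≤ 3 * ‖θ i‖ := by
  rcases i with _ | i
  · simp [dropUpTo]
  simp only [dropUpTo]
  split_ifs with hi hn
  · have hscale : (scaleColumns (θ (i + 1)) fun j => multiplier p (w ⟨i, hi⟩ j)) - θ (i + 1) =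
        scaleColumns (θ (i + 1)) fun j => multiplier p (w ⟨i, hi⟩ j) - 1 := by
      ext r j
      simp [scaleColumns, sub_mul]
    rw [hscale, mul_comm]
    exact norm_scaleColumns_le _ (by norm_num) fun j => abs_multiplier_sub_one_le hp0 hp1 _
  all_goals
    rw [sub_self, norm_zero]
    positivity

theorem norm_onSegment_dropUpTo_le {t : ℝ} (ht : t ∈ Set.Icc (0 : ℝ) 1) (n i : ℕ) :
    ‖onSegment θ (dropUpTo p w θ n) t i‖ ≤ 4 * ‖θ i‖ := by
  calc ‖onSegment θ (dropUpTo p w θ n) t i‖ ≤ ‖θ i‖ + t * ‖dropUpTo p w θ n i - θ i‖ := by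
        rw [onSegment_apply, ← norm_smul_of_nonneg ht.1]
        exact norm_add_le _ _
    _ ≤ ‖θ i‖ + 1 * (3 * ‖θ i‖) := by
        gcongr
        · exact ht.2
        · exact norm_dropUpTo_sub_le hp0 hp1 n i
    _ = 4 * ‖θ i‖ := by ring

theorem norm_onSegment_dropUpTo_sub_le (t s : ℝ) (n i : ℕ) :
    ‖onSegment θ (dropUpTo p w θ n) t i - onSegment θ (dropUpTo p w θ n) s i‖ ≤
      4 * ‖θ i‖ * |t - s| := by
  rw [onSegment_apply, onSegment_apply, add_sub_add_left_eq_sub, ← sub_smul, norm_smul,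
    Real.norm_eq_abs, mul_comm]
  gcongr
  linarith [norm_dropUpTo_sub_le (w := w) (θ := θ) hp0 hp1 n i, norm_nonneg (θ i)]

theorem norm_noisyPreact_sub_noisyPreact_time_le {t s : ℝ} (ht : t ∈ Set.Icc (0 : ℝ) 1)
    (hs : s ∈ Set.Icc (0 : ℝ) 1) {G : ℝ} (n : ℕ) (x : Vec (h 0)) {j : ℕ}
    (hG : ∀ i < j, 4 * ‖θ i‖ ≤ G) :
    ‖noisyPreact p w θ n t x j - noisyPreact p w θ n s x j‖ ≤ j * G ^ j * ‖x‖ * |t - s| :=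
  norm_preact_sub_preact_le x
    (fun i hi => (norm_onSegment_dropUpTo_le hp0 hp1 ht n i).trans (hG i hi))
    (fun i hi => (norm_onSegment_dropUpTo_le hp0 hp1 hs n i).trans (hG i hi))
    fun i hi => (norm_onSegment_dropUpTo_sub_le hp0 hp1 t s n i).trans (by gcongr; exact hG i hi)

end DropoutSegment

/-- Spread activations and columns of norm at most `K √p ‖A‖_F` keep the dropout noise of a layer of
width at least `H` within a constant multiple of this scale, relative to `‖A‖_F ‖φ(x)‖`. -/
noncomputable def noiseScale (K p H : ℝ) : ℝ := 5 * (K ^ 2 + K) * √p / √H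

theorem noiseScale_pos {K p H : ℝ} (hK : 0 < K) (hp : 0 < p) (hH : 0 < H) :
    0 < noiseScale K p H := by
  unfold noiseScale
  positivity

section OneLayer

variable {m n : ℕ} {K p H : ℝ} (hp0 : 0 < p) (hp1 : p ≤ 3 / 4)

theorem dropoutNoise_eq_sum (A : Matrix (Fin m) (Fin n) ℝ) (b : Fin n → Bool) (y : Vec n) :
    dropoutNoise p A b y = ∑ j, (multiplier p (b j) - 1) • y j • column A j :=
  toEuclideanLin_scaleColumns _ _ _

theorem norm_smul_column_le (hK : 0 ≤ K) {A : Matrix (Fin m) (Fin n) ℝ} {y : Vec n}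
    (hA : ∀ j, ‖column A j‖ ≤ K * √p * frob A) (hy : ∀ j, |y j| ≤ K / √H * ‖y‖) (j : Fin n) :
    ‖y j • column A j‖ ≤ 2 / 9 * (noiseScale K p H * (frob A * ‖y‖)) := by
  have hfrob := frob_nonneg A
  calc ‖y j • column A j‖ = |y j| * ‖column A j‖ := norm_smul _ _
    _ ≤ K / √H * ‖y‖ * (K * √p * frob A) := by
      gcongr
      · exact hy j
      · exact hA j
    _ = 1 / 5 * (5 * K ^ 2 * √p / √H * (frob A * ‖y‖)) := by ring
    _ ≤ 2 / 9 * (noiseScale K p H * (frob A * ‖y‖)) := by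
      unfold noiseScale
      refine mul_le_mul (by norm_num) ?_ (by positivity) (by norm_num)
      gcongr
      linarith

theorem mul_sum_norm_smul_column_sq_le (hK : 0 ≤ K) (hp : 0 ≤ p) {A : Matrix (Fin m) (Fin n) ℝ}
    {y : Vec n} (hy : ∀ j, |y j| ≤ K / √H * ‖y‖) :
    12 * p * ∑ j, ‖y j • column A j‖ ^ 2 ≤ (noiseScale K p H * (frob A * ‖y‖)) ^ 2 := by
  have hfrob := frob_nonneg A
  calc 12 * p * ∑ j, ‖y j • column A j‖ ^ 2
      ≤ 12 * p * ∑ j, (K / √H * ‖y‖) ^ 2 * ‖column A j‖ ^ 2 := by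
        gcongr with j
        rw [norm_smul, mul_pow]
        gcongr
        exact hy j
    _ = 12 / 25 * (5 * K * √p / √H * (frob A * ‖y‖)) ^ 2 := by
        rw [← Finset.mul_sum, ← frob_sq]
        simp only [div_pow, mul_pow, Real.sq_sqrt hp]
        ring
    _ ≤ 1 * (noiseScale K p H * (frob A * ‖y‖)) ^ 2 := by
        unfold noiseScale
        gcongr
        · norm_num
        · linarith [sq_nonneg K]
    _ = _ := one_mul _

include hp0 hp1

theorem integral_exp_norm_sum_multiplier_div_le {v : Fin n → Vec m} {D : ℝ} (hD : 0 < D)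
    (hv : ∀ j, ‖v j‖ ≤ 2 / 9 * D) (hsum : 12 * p * ∑ j, ‖v j‖ ^ 2 ≤ D ^ 2) :
    ∫ b, Real.exp (‖∑ j, (multiplier p (b j) - 1) • v j‖ / D)
        ∂Measure.pi (fun _ : Fin n => bitLaw p) ≤ Real.exp 2 := by
  have hnorm (j : Fin n) : ‖D⁻¹ • v j‖ = ‖v j‖ / D := by
    rw [norm_smul_of_nonneg (inv_nonneg.2 hD.le), inv_mul_eq_div]
  have hrescale (b : Fin n → Bool) : ‖∑ j, (multiplier p (b j) - 1) • v j‖ / D =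
      ‖∑ j, (multiplier p (b j) - 1) • D⁻¹ • v j‖ := by
    simp_rw [smul_comm _ D⁻¹]
    rw [← Finset.smul_sum, norm_smul_of_nonneg (inv_nonneg.2 hD.le), inv_mul_eq_div]
  simp_rw [hrescale]
  refine (integral_exp_norm_sum_multiplier_le hp0.le hp1 fun j => ?_).trans
    (Real.exp_le_exp.2 ?_)
  · rw [hnorm, div_le_iff₀ hD]
    exact hv j
  · have hvariance : 12 * p * ∑ j, ‖D⁻¹ • v j‖ ^ 2 ≤ 1 := by
      simp_rw [hnorm, div_pow]
      rw [← Finset.sum_div, mul_div_assoc', div_le_one (by positivity)]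
      exact hsum
    linarith

theorem integral_exp_norm_dropoutNoise_div_le (hK : 0 < K) (hH : 0 < H) (hHn : H ≤ n)
    {A : Matrix (Fin m) (Fin n) ℝ} {y : Vec n} (hA : ∀ j, ‖column A j‖ ≤ K * √p * frob A)
    (hy : ∀ j, |y j| ≤ K / √n * ‖y‖) :
    ∫ b, Real.exp (‖dropoutNoise p A b y‖ / (noiseScale K p H * (frob A * ‖y‖)))
        ∂Measure.pi (fun _ : Fin n => bitLaw p) ≤ Real.exp 2 := by
  have := isProbabilityMeasure_bitLaw hp0.le (by linarith : p ≤ 1)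
  have hfrob := frob_nonneg A
  rcases (mul_nonneg hfrob (norm_nonneg y)).eq_or_lt' with hzero | hpos
  · simp [hzero]
  have hD : 0 < noiseScale K p H * (frob A * ‖y‖) := mul_pos (noiseScale_pos hK hp0 hH) hpos
  have hyH (j : Fin n) : |y j| ≤ K / √H * ‖y‖ := (hy j).trans (by gcongr)
  simp_rw [dropoutNoise_eq_sum]
  exact integral_exp_norm_sum_multiplier_div_le hp0 hp1 hD
    (norm_smul_column_le hK.le hA hyH) (mul_sum_norm_smul_column_sq_le hK.le hp0.le hyH)

end OneLayer

section Concentration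

variable {d : ℕ} {h : ℕ → ℕ} {θ : Params h} {K p H : ℝ}

open Classical in
/-- The dropout noise of layer `m + 2` on the segment at time `t`, in units of the noise scale. It
is truncated to `0` when the activations feeding the layer are not spread out, so that its
exponential moment is bounded for every outcome of the dropout of the previous layers. -/
noncomputable def layerNoise (θ : Params h) (K p H t : ℝ) (x : Vec (h 0)) (m : Fin (d - 1))
    (w : Mask d h) : ℝ :=
  let y := relu (noisyPreact p w θ (m + 1) t x (m + 1))
  if ∀ j, |y j| ≤ K / √(h (m + 1)) * ‖y‖ then
    ‖dropoutNoise p (θ (m + 1)) (w m) y‖ / (noiseScale K p H * (frob (θ (m + 1)) * ‖y‖))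
  else 0

theorem layerNoise_update_of_lt {m m' : Fin (d - 1)} (hm : m < m') (t : ℝ) (x : Vec (h 0))
    (w : Mask d h) (a : Fin (h (m' + 1)) → Bool) :
    layerNoise θ K p H t x m (Function.update w m' a) = layerNoise θ K p H t x m w := by
  have hlt : (m : ℕ) + 1 < m' + 2 := by
    have : (m : ℕ) < m' := hm
    omega
  simp only [layerNoise]
  rw [noisyPreact_update a hlt, Function.update_of_ne hm.ne]

theorem layerNoise_nonneg (hK : 0 < K) (hp : 0 < p) (hH : 0 < H) (t : ℝ) (x : Vec (h 0))
    (m : Fin (d - 1)) (w : Mask d h) : 0 ≤ layerNoise θ K p H t x m w := by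
  have hscale := noiseScale_pos hK hp hH
  have hfrob := frob_nonneg (θ (m + 1))
  simp only [layerNoise]
  split_ifs <;> positivity

theorem norm_dropoutNoise_le_layerNoise {S : Sample d h} {w : Mask d h} (hK : 0 < K) (hp : 0 < p)
    (hH : 0 < H) (hspread : SpreadFor S θ p K w) {z : Vec (h 0) × Vec (h d)} (hz : z ∈ S)
    {m : Fin (d - 1)} (hθ : θ (m + 1) ≠ 0) {t : ℝ} (ht : t ∈ Set.Icc (0 : ℝ) 1) :
    ‖dropoutNoise p (θ (m + 1)) (w m) (relu (noisyPreact p w θ (m + 1) t z.1 (m + 1)))‖ ≤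
      noiseScale K p H * layerNoise θ K p H t z.1 m w *
        (frob (θ (m + 1)) * ‖relu (noisyPreact p w θ (m + 1) t z.1 (m + 1))‖) := by
  have hscale := noiseScale_pos hK hp hH
  have hfrob := frob_pos hθ
  have hspread' : ∀ j, |relu (noisyPreact p w θ (m + 1) t z.1 (m + 1)) j| ≤
      K / √(h (m + 1)) * ‖relu (noisyPreact p w θ (m + 1) t z.1 (m + 1))‖ :=
    hspread z hz (m + 1) (by omega) (by omega) t ht
  simp only [layerNoise]
  rw [if_pos hspread']
  set y := relu (noisyPreact p w θ (m + 1) t z.1 (m + 1))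
  rcases eq_or_ne y 0 with hy | hy
  · simp [hy, dropoutNoise]
  have := norm_pos_iff.2 hy
  refine le_of_eq ?_
  field_simp

variable (hK : 0 < K) (hp0 : 0 < p) (hp1 : p ≤ 3 / 4) (hH : 0 < H)
  (hwidth : ∀ m : Fin (d - 1), H ≤ h (m + 1))
  (hcol : ∀ m : Fin (d - 1), ∀ j, ‖column (θ (m + 1)) j‖ ≤ K * √p * frob (θ (m + 1)))
include hK hp0 hp1 hH hwidth hcol

theorem integral_exp_layerNoise_update_le (t : ℝ) (x : Vec (h 0)) (m : Fin (d - 1))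
    (w : Mask d h) :
    ∫ a, Real.exp (layerNoise θ K p H t x m (Function.update w m a))
        ∂Measure.pi (fun _ : Fin (h (m + 1)) => bitLaw p) ≤ Real.exp 2 := by
  have := isProbabilityMeasure_bitLaw hp0.le (by linarith : p ≤ 1)
  simp only [layerNoise, noisyPreact_update (p := p) (w := w) (θ := θ) (m := m) _
    (show (m : ℕ) + 1 < m + 2 by omega), Function.update_self]
  split_ifs with hspread
  · exact integral_exp_norm_dropoutNoise_div_le hp0 hp1 hK hH (hwidth m) (hcol m) hspread
  · simp

theorem dropoutLaw_real_le_sum_layerNoise_le (t : ℝ) (x : Vec (h 0)) (T : ℝ) :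
    (dropoutLaw d h p).real {w | T ≤ ∑ m, layerNoise θ K p H t x m w} ≤
      Real.exp (2 * (d - 1 : ℕ) - T) := by
  have := isProbabilityMeasure_bitLaw hp0.le (by linarith : p ≤ 1)
  have htail := measureReal_le_sum_le
    (fun m : Fin (d - 1) => Measure.pi fun _ : Fin (h (m + 1)) => bitLaw p)
    (N := fun m w => layerNoise θ K p H t x m w)
    (fun _ _ hm w a => layerNoise_update_of_lt hm t x w a)
    (integral_exp_layerNoise_update_le hK hp0 hp1 hH hwidth hcol t x)
    (fun _ => .of_finite) T
  rwa [Fintype.card_fin, ← Real.exp_nat_mul, ← Real.exp_add,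
    show -T + ((d - 1 : ℕ) : ℝ) * 2 = 2 * (d - 1 : ℕ) - T by ring] at htail

end Concentration

section Bounds

variable {d : ℕ} {h : ℕ → ℕ} {S : Sample d h} {θ : Params h} {β ε : ℝ}
  {z : Vec (h 0) × Vec (h d)}

theorem norm_le_maxInput (hz : z ∈ S) : ‖z.1‖ ≤ maxInput S :=
  le_ciSup (f := fun z : S => ‖z.1.1‖) (Finite.bddAbove_range _) ⟨z, hz⟩

theorem norm_output_le_maxOutput (hz : z ∈ S) : ‖output d θ z.1‖ ≤ maxOutput S θ :=
  le_ciSup (f := fun z : S => ‖output d θ z.1.1‖) (Finite.bddAbove_range _) ⟨z, hz⟩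

theorem maxInput_nonneg (S : Sample d h) : 0 ≤ maxInput S :=
  Real.iSup_nonneg fun _ => norm_nonneg _

theorem minWidth_le (m : Fin (d - 1)) : minWidth d h ≤ h (m + 1) :=
  ciInf_le (OrderBot.bddBelow _) m

section LogFactor

variable (hβε : 0 ≤ β / ε)
include hβε

theorem exp_logFactor : Real.exp (logFactor S θ β ε) =
    3 + (S.card : ℝ) + (d : ℝ) + maxInput S + β / ε +
      ∑ i ∈ Finset.range d, ((h (i + 1) : ℝ) + ‖θ i‖) := by
  have := maxInput_nonneg S
  have : 0 ≤ ∑ i ∈ Finset.range d, ((h (i + 1) : ℝ) + ‖θ i‖) :=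
    Finset.sum_nonneg fun i _ => by positivity
  exact Real.exp_log (by positivity)

theorem add_le_exp_logFactor :
    3 + (S.card : ℝ) + (d : ℝ) + maxInput S + β / ε ≤ Real.exp (logFactor S θ β ε) := by
  rw [exp_logFactor hβε]
  exact le_add_of_nonneg_right (Finset.sum_nonneg fun i _ => by positivity)

theorem three_add_depth_le_exp_logFactor : 3 + (d : ℝ) ≤ Real.exp (logFactor S θ β ε) := by
  linarith [add_le_exp_logFactor (S := S) (θ := θ) hβε, maxInput_nonneg S,
    Nat.cast_nonneg (α := ℝ) S.card]

theorem card_le_exp_logFactor : (S.card : ℝ) ≤ Real.exp (logFactor S θ β ε) := by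
  linarith [add_le_exp_logFactor (S := S) (θ := θ) hβε, maxInput_nonneg S,
    Nat.cast_nonneg (α := ℝ) d]

theorem norm_le_exp_logFactor (hz : z ∈ S) : ‖z.1‖ ≤ Real.exp (logFactor S θ β ε) := by
  linarith [add_le_exp_logFactor (S := S) (θ := θ) hβε, norm_le_maxInput hz,
    Nat.cast_nonneg (α := ℝ) d, Nat.cast_nonneg (α := ℝ) S.card]

theorem div_le_exp_logFactor : β / ε ≤ Real.exp (logFactor S θ β ε) := by
  linarith [add_le_exp_logFactor (S := S) (θ := θ) hβε, maxInput_nonneg S,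
    Nat.cast_nonneg (α := ℝ) d, Nat.cast_nonneg (α := ℝ) S.card]

theorem width_add_norm_weight_le_exp_logFactor {i : ℕ} (hi : i < d) :
    (h (i + 1) : ℝ) + ‖θ i‖ ≤ Real.exp (logFactor S θ β ε) := by
  have := maxInput_nonneg S
  rw [exp_logFactor hβε]
  exact (Finset.single_le_sum (f := fun i => (h (i + 1) : ℝ) + ‖θ i‖)
    (fun i _ => by positivity) (Finset.mem_range.2 hi)).trans
    (le_add_of_nonneg_left (by positivity))

theorem one_le_logFactor : 1 ≤ logFactor S θ β ε := by
  rw [← Real.exp_le_exp]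
  linarith [three_add_depth_le_exp_logFactor (S := S) (θ := θ) hβε, Real.exp_one_lt_three,
    Nat.cast_nonneg (α := ℝ) d]

end LogFactor

section NoiseParameter

variable (hS : S.Nonempty) (hout : ∀ z ∈ S, output d θ z.1 ≠ 0)
include hS hout

theorem maxOutput_pos : 0 < maxOutput S θ := by
  obtain ⟨z, hz⟩ := hS
  exact (norm_pos_iff.2 (hout z hz)).trans_le (norm_output_le_maxOutput hz)

variable (hd : 2 ≤ d)
include hd

theorem minWidth_pos : 0 < minWidth d h := by
  obtain ⟨z, hz⟩ := hS
  have : Nonempty (Fin (d - 1)) := ⟨⟨0, by omega⟩⟩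
  refine le_ciInf fun m => Nat.one_le_iff_ne_zero.2 fun hzero => ?_
  have : IsEmpty (Fin (h (m + 1))) := hzero ▸ Fin.isEmpty
  exact preact_ne_zero (hout z hz) (i := m + 1) (by omega) (Subsingleton.elim _ _)

theorem noiseParameter_pos (hβ : 0 < β) : 0 < noiseParameter S θ β := by
  have hwidth := minWidth_pos hS hout hd
  have hmax := maxOutput_pos hS hout
  have hcushion := minCushion_pos hS hout hd
  have hcontraction := activationContraction_pos hS hout hd
  unfold noiseParameter
  positivity

theorem noiseParameter_nonneg (hβ : 0 ≤ β) : 0 ≤ noiseParameter S θ β := by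
  rcases hβ.eq_or_lt with rfl | hβ
  · simp [noiseParameter]
  · exact (noiseParameter_pos hS hout hd hβ).le

theorem le_noiseParameter_mul_exp_logFactor (hβ : 0 ≤ β) :
    β ≤ noiseParameter S θ β * Real.exp (logFactor S θ β (noiseParameter S θ β)) := by
  rcases hβ.eq_or_lt with rfl | hβ
  · simp [noiseParameter]
  · have hε := noiseParameter_pos hS hout hd hβ
    exact (div_le_iff₀' hε).1 (div_le_exp_logFactor (by positivity))

theorem mul_noiseGain_mul_noiseScale_le {K p : ℝ} (hK : 0 ≤ K) (hβ : 0 ≤ β) :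
    β * maxOutput S θ * (noiseGain S θ * (noiseScale K p (minWidth d h) * d)) ≤
      5 * (K ^ 2 + K) * (√p * noiseParameter S θ β) := by
  have hmax := maxOutput_pos hS hout
  have hcushion := minCushion_pos hS hout hd
  have hcontraction := activationContraction_pos hS hout hd
  have hd1 : (1 : ℝ) ≤ d := by exact_mod_cast (by omega : 1 ≤ d)
  calc β * maxOutput S θ * (noiseGain S θ * (noiseScale K p (minWidth d h) * d))
      ≤ β * maxOutput S θ *
          (noiseGain S θ * (noiseScale K p (minWidth d h) * (d : ℝ) ^ (3 / 2 : ℝ))) := by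
        unfold noiseGain noiseScale
        gcongr
        exact Real.self_le_rpow_of_one_le hd1 (by norm_num)
    _ = _ := by
        unfold noiseGain noiseScale noiseParameter
        field_simp

end NoiseParameter

end Bounds

section Loss

variable {d : ℕ} {h : ℕ → ℕ} {l : Vec (h d) → Vec (h d) → ℝ} {S : Sample d h}
  {θ θ' : Params h} {β b : ℝ}

theorem loss_le_loss_add (hS : S.Nonempty)
    (hl : ∀ z ∈ S, l z.2 (output d θ' z.1) ≤ l z.2 (output d θ z.1) + b) :
    loss l S θ' ≤ loss l S θ + b := by
  have : (0 : ℝ) < S.card := by exact_mod_cast hS.card_pos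
  unfold loss
  calc _ ≤ 1 / (S.card : ℝ) * ∑ z ∈ S, (l z.2 (output d θ z.1) + b) := by
        gcongr with z hz
        exact hl z hz
    _ = _ := by
        rw [Finset.sum_add_distrib, Finset.sum_const, nsmul_eq_mul]
        field_simp

theorem loss_le_loss_add_of_norm_output_sub_le (hS : S.Nonempty)
    (hl : ∀ y a b, |l y a - l y b| ≤ β * ‖a - b‖)
    (hb : ∀ z ∈ S, β * ‖output d θ' z.1 - output d θ z.1‖ ≤ b) :
    loss l S θ' ≤ loss l S θ + b :=
  loss_le_loss_add hS fun z hz => sub_le_iff_le_add'.1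
    ((le_abs_self _).trans ((hl _ _ _).trans (hb z hz)))

end Loss

section DropoutStability

variable {d : ℕ} {h : ℕ → ℕ}

theorem dropoutLaw_real_exists_half_lt_card_kept_lt {L : ℝ} (hd : 3 + (d : ℝ) ≤ Real.exp L)
    (hwidth : 16 * L ≤ minWidth d h) :
    (dropoutLaw d h (3 / 4)).real
      {w | ∃ i : Fin (d - 1), h (i + 1) / 2 < (Finset.univ.filter fun j => w i j = true).card} <
        1 / 4 := by
  rw [Set.ofPred_exists]
  calc _ ≤ ∑ i : Fin (d - 1), Real.exp (-2 * h (i + 1) * (3 / 4 - 1 / 2) ^ 2) :=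
        (measureReal_iUnion_fintype_le _).trans (Finset.sum_le_sum fun i _ =>
          dropoutLaw_real_half_lt_card_kept_le (by norm_num) (by norm_num) i)
    _ ≤ ∑ _i : Fin (d - 1), Real.exp (-(2 * L)) := by
        refine Finset.sum_le_sum fun i _ => Real.exp_le_exp.2 ?_
        have : (minWidth d h : ℝ) ≤ h (i + 1) := by exact_mod_cast minWidth_le i
        linarith
    _ = (d - 1 : ℕ) / Real.exp L ^ 2 := by
        rw [Finset.sum_const, Finset.card_univ, Fintype.card_fin, nsmul_eq_mul, Real.exp_neg,
          ← Real.exp_nat_mul, Nat.cast_two, div_eq_mul_inv]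
    _ ≤ d / Real.exp L ^ 2 := by
        gcongr
        omega
    _ < 1 / 4 := by
        rw [div_lt_div_iff₀ (by positivity) (by norm_num)]
        nlinarith [Nat.cast_nonneg (α := ℝ) d]

variable {l : Vec (h d) → Vec (h d) → ℝ} {S : Sample d h} {θ : Params h} {η p : ℝ}

theorem isDropoutStable_of_card_kept_le {w : Mask d h}
    (hloss : loss l S (dropUpTo p w θ d) ≤ loss l S θ + η)
    (hkept : ∀ i, (Finset.univ.filter fun j => w i j = true).card ≤ h (i + 1) / 2) :
    IsDropoutStable l S θ η := by
  let kept : (i : ℕ) → Finset (Fin (h i))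
    | 0 => ∅
    | i + 1 => if hi : i < d - 1 then Finset.univ.filter fun j => w ⟨i, hi⟩ j = true else ∅
  refine ⟨1 / (1 - p), kept, dropUpTo p w θ d, fun i hi hid => ?_, rfl, fun i hi hid => ?_, hloss⟩
  · obtain ⟨i, rfl⟩ := Nat.exists_eq_add_of_le' hi
    have hid' : i < d - 1 := by omega
    simp only [kept, hid', dif_pos]
    exact hkept ⟨i, hid'⟩
  · obtain ⟨i, rfl⟩ := Nat.exists_eq_add_of_le' hi
    have hid' : i < d - 1 := by omega
    simp only [kept, dropUpTo, hid', dif_pos, show i + 2 ≤ d by omega, if_true, multiplier,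
      Finset.mem_filter, Finset.mem_univ, true_and]

theorem isDropoutStable_of_dropoutLaw_real {L : ℝ} (hd : 3 + (d : ℝ) ≤ Real.exp L)
    (hwidth : 16 * L ≤ minWidth d h)
    (hloss : 1 / 4 ≤ (dropoutLaw d h (3 / 4)).real
      {w | loss l S (dropUpTo (3 / 4) w θ d) ≤ loss l S θ + η}) :
    IsDropoutStable l S θ η := by
  have := isProbabilityMeasure_dropoutLaw d h (p := 3 / 4) (by norm_num) (by norm_num)
  by_contra hstable
  refine (dropoutLaw_real_exists_half_lt_card_kept_lt hd hwidth).not_ge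
    (hloss.trans (measureReal_mono fun w hw => ?_))
  by_contra hkept
  exact hstable (isDropoutStable_of_card_kept_le hw fun i => not_lt.1 fun hi => hkept ⟨i, hi⟩)

end DropoutStability

theorem exists_nat_div_mem_Icc {N : ℕ} (hN : 0 < N) {t : ℝ} (ht : t ∈ Set.Icc (0 : ℝ) 1) :
    ∃ k ≤ N, (k : ℝ) / N ∈ Set.Icc (0 : ℝ) 1 ∧ |t - (k : ℝ) / N| ≤ 1 / N := by
  have hN' : (0 : ℝ) < N := by exact_mod_cast hN
  have hfloor := Nat.floor_le (mul_nonneg ht.1 hN'.le)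
  have hfloor' := Nat.lt_floor_add_one (t * N)
  have hk : (⌊t * N⌋₊ : ℝ) ≤ N := hfloor.trans (mul_le_of_le_one_left hN'.le ht.2)
  refine ⟨⌊t * N⌋₊, by exact_mod_cast hk, ⟨by positivity, div_le_one_of_le₀ hk hN'.le⟩, ?_⟩
  rw [show t - (⌊t * N⌋₊ : ℝ) / N = (t * N - ⌊t * N⌋₊) / N by field_simp, abs_div,
    abs_of_pos hN']
  gcongr
  rw [abs_le]
  constructor <;> linarith

theorem exp_neg_le_of_one_le_mul_sq {L a b : ℝ} (hL : 0 ≤ L) (hb : 0 ≤ b) (ha : a ≤ Real.exp L)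
    (hab : 1 ≤ a * b ^ 2) : Real.exp (-L) ≤ b := by
  refine le_of_sq_le_sq ?_ hb
  calc Real.exp (-L) ^ 2 ≤ Real.exp (-L) * 1 := by
        rw [sq]
        gcongr
        exact Real.exp_le_one_iff.2 (by linarith)
    _ ≤ Real.exp (-L) * (Real.exp L * b ^ 2) := by
        gcongr
        exact hab.trans (by gcongr)
    _ = b ^ 2 := by rw [← mul_assoc, ← Real.exp_add, neg_add_cancel, Real.exp_zero, one_mul]

section Grid

variable {d : ℕ} {h : ℕ → ℕ} {S : Sample d h} {θ : Params h} {K p H L : ℝ}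
  (hd : 2 ≤ d) (hp0 : 0 < p) (hp1 : p ≤ 3 / 4) (hL : 1 ≤ L) (hdL : 3 + (d : ℝ) ≤ Real.exp L)
include hd hp0 hp1 hL hdL

theorem mul_norm_noisyPreact_sub_noisyPreact_time_le {β ε : ℝ} (hβε : β ≤ ε * Real.exp L)
    (hε : 0 ≤ ε) (hθ : ∀ i < d, ‖θ i‖ ≤ Real.exp L) {x : Vec (h 0)} (hx : ‖x‖ ≤ Real.exp L)
    {N : ℝ} (hN : Real.exp (4 * d * L) ≤ N) (w : Mask d h) {t s : ℝ}
    (ht : t ∈ Set.Icc (0 : ℝ) 1) (hs : s ∈ Set.Icc (0 : ℝ) 1) (hts : |t - s| ≤ 1 / N) :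
    β * ‖noisyPreact p w θ d t x d - noisyPreact p w θ d s x d‖ ≤ ε * Real.exp (-L) := by
  have hd2 : (2 : ℝ) ≤ d := by exact_mod_cast hd
  have hG (i : ℕ) (hi : i < d) : 4 * ‖θ i‖ ≤ Real.exp (2 * L) := by
    rw [two_mul, Real.exp_add]
    exact mul_le_mul (by linarith) (hθ i hi) (norm_nonneg _) (Real.exp_pos _).le
  have hts' : |t - s| ≤ Real.exp (-(4 * d * L)) := by
    rw [Real.exp_neg, ← one_div]
    exact hts.trans (one_div_le_one_div_of_le (Real.exp_pos _) hN)
  calc β * ‖noisyPreact p w θ d t x d - noisyPreact p w θ d s x d‖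
      ≤ ε * Real.exp L * (d * Real.exp (2 * L) ^ d * ‖x‖ * |t - s|) :=
        mul_le_mul hβε (norm_noisyPreact_sub_noisyPreact_time_le hp0.le hp1 ht hs d x hG)
          (norm_nonneg _) (by positivity)
    _ ≤ ε * Real.exp L *
          (Real.exp L * Real.exp (2 * L) ^ d * Real.exp L * Real.exp (-(4 * d * L))) := by
        gcongr
        linarith
    _ = ε * Real.exp (3 * L - 2 * d * L) := by
        rw [← Real.exp_nat_mul, mul_assoc, ← Real.exp_add, ← Real.exp_add, ← Real.exp_add,
          ← Real.exp_add]
        ring_nf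
    _ ≤ ε * Real.exp (-L) := by
        gcongr
        linarith [mul_le_mul_of_nonneg_right hd2 (by linarith : 0 ≤ L)]

theorem dropoutLaw_real_exists_grid_le_sum_layerNoise_le (hK : 0 < K) (hH : 0 < H)
    (hwidth : ∀ m : Fin (d - 1), H ≤ h (m + 1))
    (hcol : ∀ m : Fin (d - 1), ∀ j, ‖column (θ (m + 1)) j‖ ≤ K * √p * frob (θ (m + 1)))
    (hS : (S.card : ℝ) ≤ Real.exp L) {N : ℕ} (hN : (N : ℝ) ≤ Real.exp (4 * d * L) + 1) :
    (dropoutLaw d h p).real {w | ∃ a ∈ S ×ˢ Finset.range (N + 1),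
      8 * d * L ≤ ∑ m, layerNoise θ K p H ((a.2 : ℝ) / N) a.1.1 m w} ≤ 1 / 4 := by
  have hd2 : (2 : ℝ) ≤ d := by exact_mod_cast hd
  have hcard : (N : ℝ) + 1 ≤ Real.exp L * Real.exp (4 * d * L) := by
    have : 1 ≤ Real.exp (4 * d * L) := Real.one_le_exp (by positivity)
    nlinarith
  rw [show {w : Mask d h | ∃ a ∈ S ×ˢ Finset.range (N + 1),
      8 * d * L ≤ ∑ m, layerNoise θ K p H ((a.2 : ℝ) / N) a.1.1 m w} =
      ⋃ a ∈ S ×ˢ Finset.range (N + 1),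
        {w | 8 * d * L ≤ ∑ m, layerNoise θ K p H ((a.2 : ℝ) / N) a.1.1 m w} by ext; simp]
  calc _ ≤ ∑ _a ∈ S ×ˢ Finset.range (N + 1), Real.exp (2 * (d - 1 : ℕ) - 8 * d * L) :=
        (measureReal_biUnion_finset_le _ _).trans (Finset.sum_le_sum fun _ _ =>
          dropoutLaw_real_le_sum_layerNoise_le hK hp0 hp1 hH hwidth hcol _ _ _)
    _ = S.card * ((N : ℝ) + 1) * Real.exp (2 * (d - 1 : ℕ) - 8 * d * L) := by
        rw [Finset.sum_const, Finset.card_product, Finset.card_range, nsmul_eq_mul]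
        push_cast
        ring
    _ ≤ Real.exp L * (Real.exp L * Real.exp (4 * d * L)) *
          Real.exp (2 * (d - 1 : ℕ) - 8 * d * L) := by gcongr
    _ = Real.exp (2 * L + 2 * (d - 1 : ℕ) - 4 * d * L) := by
        rw [← Real.exp_add, ← Real.exp_add, ← Real.exp_add]
        ring_nf
    _ ≤ Real.exp (-3) := by
        rw [Nat.cast_sub (by omega), Nat.cast_one, Real.exp_le_exp]
        nlinarith
    _ ≤ 1 / 4 := by
        rw [Real.exp_neg, ← one_div]
        exact one_div_le_one_div_of_le (by norm_num) (by linarith [Real.add_one_le_exp (3 : ℝ)])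

end Grid

section Endpoint

variable {d : ℕ} {h : ℕ → ℕ} {S : Sample d h} {θ : Params h} {K p H ρ t : ℝ} {w : Mask d h}
  {z : Vec (h 0) × Vec (h d)}
  (hK : 0 < K) (hd : 2 ≤ d) (hS : S.Nonempty) (hout : ∀ z ∈ S, output d θ z.1 ≠ 0) (hp0 : 0 < p)
  (hρ : 3 * (d : ℝ) ≤ ρ) (hsmooth : SmoothFor S θ p ρ w) (hspread : SpreadFor S θ p K w)
  (hz : z ∈ S) (ht : t ∈ Set.Icc (0 : ℝ) 1)
include hK hd hS hout hp0 hρ hsmooth hspread hz ht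

theorem norm_noisyPreact_sub_output_le (hH : 0 < H) {a : ℝ}
    (ha : noiseGain S θ * (noiseScale K p H * ∑ m, layerNoise θ K p H t z.1 m w) ≤ a) :
    ‖noisyPreact p w θ d t z.1 d - output d θ z.1‖ ≤
      2 * a * Real.exp (2 * a + 1) * ‖output d θ z.1‖ := by
  have hgain := noiseGain_pos hd hS hout
  set η : ℕ → ℝ := fun m => if hm : m < d - 1 then
    noiseScale K p H * layerNoise θ K p H t z.1 ⟨m, hm⟩ w else 0 with hη
  have hη_nonneg (m : ℕ) : 0 ≤ η m := by
    simp only [hη]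
    split_ifs
    · exact mul_nonneg (noiseScale_pos hK hp0 hH).le (layerNoise_nonneg hK hp0 hH _ _ _ _)
    · exact le_rfl
  have hη_fin (m : Fin (d - 1)) : η m = noiseScale K p H * layerNoise θ K p H t z.1 m w := by
    simp [hη]
  have hsum : ∑ i ∈ Finset.range (d - 1), 2 * (noiseGain S θ * η i) ≤ 2 * a := by
    rw [← Finset.mul_sum, ← Finset.mul_sum, Finset.sum_range]
    simp only [hη_fin, ← Finset.mul_sum]
    linarith
  have hsum_nonneg : 0 ≤ ∑ i ∈ Finset.range (d - 1), 2 * (noiseGain S θ * η i) :=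
    Finset.sum_nonneg fun i _ => mul_nonneg two_pos.le (mul_nonneg hgain.le (hη_nonneg i))
  have herror := norm_noisyPreact_sub_preact_le hd hS hout hz ht hρ hsmooth hη_nonneg
    (fun m => by
      rw [hη_fin]
      exact norm_dropoutNoise_le_layerNoise hK hp0 hH hspread hz
        (weight_ne_zero (hout z hz) (by omega)) ht)
    (d - 1) (by omega) (j := d) (by omega) le_rfl
  rw [Nat.sub_add_cancel (by omega : 1 ≤ d)] at herror
  refine herror.trans ?_
  have hdepth : ((d - 1 : ℕ) : ℝ) / d ≤ 1 :=
    div_le_one_of_le₀ (by exact_mod_cast Nat.sub_le d 1) (by positivity)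
  have ha_nonneg := hsum_nonneg.trans hsum
  unfold output
  gcongr

theorem mul_norm_noisyPreact_sub_output_le {β L : ℝ} (hβ : 0 ≤ β) (hL : 0 ≤ L)
    (hnoise : ∑ m, layerNoise θ K p (minWidth d h) t z.1 m w ≤ 8 * d * L)
    (hcond : √p * noiseParameter S θ β * L ≤ K * (β * maxOutput S θ)) :
    β * ‖noisyPreact p w θ d t z.1 d - output d θ z.1‖ ≤
      80 * (K ^ 2 + K) * Real.exp (80 * (K ^ 2 + K) * K + 1) *
        (√p * noiseParameter S θ β * L) := by
  rcases hβ.eq_or_lt with rfl | hβ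
  · simp [noiseParameter]
  have hwidth : (0 : ℝ) < minWidth d h := by exact_mod_cast minWidth_pos hS hout hd
  have hmax := maxOutput_pos hS hout
  have hgain := noiseGain_pos hd hS hout
  have hscale := noiseScale_pos hK hp0 hwidth
  have := noiseParameter_nonneg (β := β) hS hout hd hβ.le
  set a := noiseGain S θ * (noiseScale K p (minWidth d h) * (8 * d * L)) with ha
  have : 0 ≤ a := by positivity
  have haβ : β * maxOutput S θ * a ≤ 40 * (K ^ 2 + K) * (√p * noiseParameter S θ β * L) := by
    have hgain_mul := mul_le_mul_of_nonneg_right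
      (mul_noiseGain_mul_noiseScale_le (p := p) hS hout hd hK.le hβ.le) (by positivity : 0 ≤ 8 * L)
    rw [ha]
    linarith
  have haK : a ≤ 40 * (K ^ 2 + K) * K := by
    refine le_of_mul_le_mul_left ?_ (mul_pos hβ hmax)
    refine (haβ.trans (mul_le_mul_of_nonneg_left hcond (by positivity))).trans_eq ?_
    ring
  calc β * ‖noisyPreact p w θ d t z.1 d - output d θ z.1‖
      ≤ β * (2 * a * Real.exp (2 * a + 1) * maxOutput S θ) := by
        gcongr
        refine (norm_noisyPreact_sub_output_le hK hd hS hout hp0 hρ hsmooth hspread hz ht hwidth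
          (mul_le_mul_of_nonneg_left (mul_le_mul_of_nonneg_left hnoise hscale.le)
            hgain.le)).trans ?_
        gcongr
        exact norm_output_le_maxOutput hz
    _ = 2 * Real.exp (2 * a + 1) * (β * maxOutput S θ * a) := by ring
    _ ≤ 2 * Real.exp (80 * (K ^ 2 + K) * K + 1) *
          (40 * (K ^ 2 + K) * (√p * noiseParameter S θ β * L)) := by
        gcongr 2 * Real.exp ?_ * ?_
        linarith
    _ = _ := by ring

end Endpoint

/-- The constant `C` of the stability bound: the exponential term bounds the loss at the points of
a grid of the segment, `K` accounts for the points in between, and `16` makes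
`C Λ ≤ h_min` large enough for the hidden layers to keep at most half of their units. -/
noncomputable def stabilityConstant (K : ℝ) : ℝ :=
  80 * (K ^ 2 + K) * Real.exp (80 * (K ^ 2 + K) * K + 1) + K + 16

theorem sixteen_le_stabilityConstant {K : ℝ} (hK : 0 < K) : 16 ≤ stabilityConstant K := by
  unfold stabilityConstant
  exact le_add_of_nonneg_left (by positivity)

theorem lipschitz_const_nonneg {d : ℕ} {h : ℕ → ℕ} {l : Vec (h d) → Vec (h d) → ℝ} {β : ℝ}
    (hl : ∀ y a b, |l y a - l y b| ≤ β * ‖a - b‖) {v : Vec (h d)} (hv : v ≠ 0) : 0 ≤ β := by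
  refine nonneg_of_mul_nonneg_left ?_ (norm_pos_iff.2 hv)
  simpa using (abs_nonneg _).trans (hl 0 v 0)

section Segment

variable {d : ℕ} {h : ℕ → ℕ} {l : Vec (h d) → Vec (h d) → ℝ} {S : Sample d h} {θ : Params h}
  {K p β ε L ρ : ℝ}
  (hK : 0 < K) (hd : 2 ≤ d) (hS : S.Nonempty) (hout : ∀ z ∈ S, output d θ z.1 ≠ 0)
  (hβ : 0 ≤ β) (hp0 : 0 < p) (hp1 : p ≤ 3 / 4) (hρ : 3 * (d : ℝ) ≤ ρ)
  (hl : ∀ y a b, |l y a - l y b| ≤ β * ‖a - b‖)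
  (hcol : ∀ i, 1 ≤ i → i < d → ∀ j, ‖column (θ i) j‖ ≤ K * √p * frob (θ i))
  (hε : ε = noiseParameter S θ β) (hL : L = logFactor S θ β ε)
  (hcond : √p * ε * L ≤ K * (β * maxOutput S θ))

include hK hd hS hout hβ hcol hε hL in
theorem exp_neg_logFactor_le : Real.exp (-L) ≤ K * √p := by
  have hβε : 0 ≤ β / ε := div_nonneg hβ (hε ▸ noiseParameter_nonneg hS hout hd hβ)
  obtain ⟨z, hz⟩ := hS
  refine exp_neg_le_of_one_le_mul_sq (a := h 1) ?_ (by positivity) ?_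
    (one_le_card_mul_sq_of_norm_column_le (weight_ne_zero (hout z hz) (by omega))
      (hcol 1 le_rfl (by omega)))
  · exact hL ▸ zero_le_one.trans (one_le_logFactor hβε)
  · have := width_add_norm_weight_le_exp_logFactor (S := S) (θ := θ) hβε (i := 0) (by omega)
    rw [hL]
    linarith [norm_nonneg (θ 0)]

include hK hd hS hout hβ hp0 hp1 hcol hε hL in
theorem mul_norm_noisyPreact_time_sub_le {N k : ℕ} (hN : Real.exp (4 * d * L) ≤ N) (w : Mask d h)
    {z : Vec (h 0) × Vec (h d)} (hz : z ∈ S) {t : ℝ} (ht : t ∈ Set.Icc (0 : ℝ) 1)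
    (hk : (k / N : ℝ) ∈ Set.Icc (0 : ℝ) 1) (htk : |t - k / N| ≤ 1 / N) :
    β * ‖noisyPreact p w θ d t z.1 d - noisyPreact p w θ d (k / N) z.1 d‖ ≤
      K * (√p * ε * L) := by
  have hε0 : 0 ≤ ε := hε ▸ noiseParameter_nonneg hS hout hd hβ
  have hβε : 0 ≤ β / ε := div_nonneg hβ hε0
  have hL1 : 1 ≤ L := hL ▸ one_le_logFactor hβε
  have hexp := exp_neg_logFactor_le hK hd hS hout hβ hcol hε hL
  calc β * ‖noisyPreact p w θ d t z.1 d - noisyPreact p w θ d (k / N) z.1 d‖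
      ≤ ε * Real.exp (-L) := by
        refine mul_norm_noisyPreact_sub_noisyPreact_time_le hd hp0 hp1 hL1
          (hL ▸ three_add_depth_le_exp_logFactor hβε) ?_ hε0 (fun i hi => ?_)
          (hL ▸ norm_le_exp_logFactor hβε hz) hN w ht hk htk
        · rw [hL, hε]
          exact le_noiseParameter_mul_exp_logFactor hS hout hd hβ
        · rw [hL]
          linarith [width_add_norm_weight_le_exp_logFactor (S := S) (θ := θ) hβε hi,
            Nat.cast_nonneg (α := ℝ) (h (i + 1))]
    _ ≤ ε * (K * √p) := by gcongr
    _ ≤ ε * (K * √p) * L := le_mul_of_one_le_right (by positivity) hL1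
    _ = K * (√p * ε * L) := by ring

include hK hd hS hout hβ hp0 hp1 hρ hl hcol hε hL hcond in
theorem loss_onSegment_le {w : Mask d h} (hsmooth : SmoothFor S θ p ρ w)
    (hspread : SpreadFor S θ p K w) {N : ℕ} (hN : Real.exp (4 * d * L) ≤ N)
    (hgrid : ∀ a ∈ S ×ˢ Finset.range (N + 1),
      ∑ m, layerNoise θ K p (minWidth d h) ((a.2 : ℝ) / N) a.1.1 m w ≤ 8 * d * L)
    {t : ℝ} (ht : t ∈ Set.Icc (0 : ℝ) 1) :
    loss l S (onSegment θ (dropUpTo p w θ d) t) ≤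
      loss l S θ + stabilityConstant K * (√p * ε * L) := by
  have hε0 : 0 ≤ ε := hε ▸ noiseParameter_nonneg hS hout hd hβ
  have hL0 : 0 ≤ L := zero_le_one.trans (hL ▸ one_le_logFactor (div_nonneg hβ hε0))
  have hN0 : 0 < N := by exact_mod_cast (Real.exp_pos _).trans_le hN
  refine loss_le_loss_add_of_norm_output_sub_le hS hl fun z hz => ?_
  obtain ⟨k, hkN, hk, htk⟩ := exists_nat_div_mem_Icc hN0 ht
  have htime := mul_norm_noisyPreact_time_sub_le hK hd hS hout hβ hp0 hp1 hcol hε hL hN w hz ht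
    hk htk
  have hpoint := mul_norm_noisyPreact_sub_output_le hK hd hS hout hp0 hρ hsmooth hspread hz hk hβ
    hL0 (hgrid (z, k) (by simp [hz, hkN])) (hε ▸ hcond)
  have htriangle := mul_le_mul_of_nonneg_left (norm_sub_le_norm_sub_add_norm_sub
    (noisyPreact p w θ d t z.1 d) (noisyPreact p w θ d (k / N) z.1 d) (output d θ z.1)) hβ
  have hX : 0 ≤ √p * ε * L := by positivity
  change β * ‖noisyPreact p w θ d t z.1 d - output d θ z.1‖ ≤ _
  rw [← hε] at hpoint
  unfold stabilityConstant
  linarith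

include hK hd hS hout hβ hp1 hρ hl hcol hε hL hcond in
theorem dropoutLaw_real_loss_onSegment_le
    (hgood : 1 / 2 ≤ (dropoutLaw d h p).real {w | SmoothFor S θ p ρ w ∧ SpreadFor S θ p K w}) :
    1 / 4 ≤ (dropoutLaw d h p).real {w | ∀ t ∈ Set.Icc (0 : ℝ) 1,
      loss l S (onSegment θ (dropUpTo p w θ d) t) ≤
        loss l S θ + stabilityConstant K * (√p * ε * L)} := by
  have hp0 : 0 < p := Real.sqrt_pos.1 <| pos_of_mul_pos_right
    ((Real.exp_pos _).trans_le (exp_neg_logFactor_le hK hd hS hout hβ hcol hε hL)) hK.le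
  have hβε : 0 ≤ β / ε := div_nonneg hβ (hε ▸ noiseParameter_nonneg hS hout hd hβ)
  have := isProbabilityMeasure_dropoutLaw d h hp0.le (by linarith : p ≤ 1)
  set N := ⌈Real.exp (4 * d * L)⌉₊
  set good := {w | SmoothFor S θ p ρ w ∧ SpreadFor S θ p K w}
  set target := {w : Mask d h | ∀ t ∈ Set.Icc (0 : ℝ) 1,
    loss l S (onSegment θ (dropUpTo p w θ d) t) ≤
      loss l S θ + stabilityConstant K * (√p * ε * L)}
  set noisy := {w : Mask d h | ∃ a ∈ S ×ˢ Finset.range (N + 1),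
    8 * d * L ≤ ∑ m, layerNoise θ K p (minWidth d h) ((a.2 : ℝ) / N) a.1.1 m w}
  have hnoisy : (dropoutLaw d h p).real noisy ≤ 1 / 4 :=
    dropoutLaw_real_exists_grid_le_sum_layerNoise_le hd hp0 hp1 (hL ▸ one_le_logFactor hβε)
      (hL ▸ three_add_depth_le_exp_logFactor hβε) hK
      (Nat.cast_pos.2 (minWidth_pos hS hout hd))
      (fun m => Nat.cast_le.2 (minWidth_le m)) (fun m => hcol (m + 1) (by omega) (by omega))
      (hL ▸ card_le_exp_logFactor hβε) (Nat.ceil_lt_add_one (Real.exp_pos _).le).le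
  have hsub : good ⊆ target ∪ noisy := fun w hw => or_iff_not_imp_right.2 fun hquiet _ ht =>
    loss_onSegment_le hK hd hS hout hβ hp0 hp1 hρ hl hcol hε hL hcond hw.1 hw.2
      (Nat.le_ceil _) (fun a ha => le_of_not_ge fun hle => hquiet ⟨a, ha, hle⟩) ht
  linarith [measureReal_mono (μ := dropoutLaw d h p) hsub,
    measureReal_union_le (μ := dropoutLaw d h p) target noisy]

end Segment

end ReluNet

theorem lemma3_general {d : ℕ} {h : ℕ → ℕ} {l : ReluNet.Vec (h d) → ReluNet.Vec (h d) → ℝ}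
    {S : ReluNet.Sample d h} {θ : ReluNet.Params h} {β p ε K H : ℝ} (hK : 0 < K) (hd : 2 ≤ d)
    (hS : S.Nonempty) (hl : ∀ y a b, |l y a - l y b| ≤ β * ‖a - b‖)
    (hstable : ReluNet.IsNoiseStable S θ β p K H ε) (hp : p ≤ 3 / 4)
    (hcol : ∀ i, 1 ≤ i → i < d → ∀ j,
      ‖ReluNet.column (θ i) j‖ ≤ K * √p * ReluNet.frob (θ i))
    (hcond : √p * ε * ReluNet.logFactor S θ β ε ≤ K * (β * ReluNet.maxOutput S θ)) :
    (1 / 4 ≤ (ReluNet.dropoutLaw d h p).real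
        {w | ∀ t ∈ Set.Icc (0 : ℝ) 1,
          ReluNet.loss l S (ReluNet.onSegment θ (ReluNet.dropUpTo p w θ d) t) ≤
            ReluNet.loss l S θ +
              ReluNet.stabilityConstant K * (√p * ε * ReluNet.logFactor S θ β ε)}) ∧
    (p = 3 / 4 → 16 * ReluNet.logFactor S θ β ε ≤ H → ReluNet.IsDropoutStable l S θ
      (ReluNet.stabilityConstant K * (√p * ε * ReluNet.logFactor S θ β ε))) := by
  obtain ⟨hout, hε, hwidth, ρ, hρ, hgood⟩ := hstable
  obtain ⟨z, hz⟩ := id hS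
  have hβ := ReluNet.lipschitz_const_nonneg hl (hout z hz)
  have hprob := ReluNet.dropoutLaw_real_loss_onSegment_le hK hd hS hout hβ hp hρ hl hcol hε rfl
    hcond hgood
  refine ⟨hprob, ?_⟩
  rintro rfl hH
  have := ReluNet.isProbabilityMeasure_dropoutLaw d h (p := 3 / 4) (by norm_num) (by norm_num)
  have hβε : 0 ≤ β / ε := div_nonneg hβ (hε ▸ ReluNet.noiseParameter_nonneg hS hout hd hβ)
  refine ReluNet.isDropoutStable_of_dropoutLaw_real
    (ReluNet.three_add_depth_le_exp_logFactor hβε) (hH.trans hwidth)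
    (hprob.trans (measureReal_mono fun w hw => ?_))
  simpa [ReluNet.onSegment] using hw 1 (by simp)

theorem lemma3 :
    ∃ k : ℕ, ∀ K : ℝ, 0 < K → ∃ C : ℝ, 0 < C ∧
      ∀ (d : ℕ) (h : ℕ → ℕ) (l : ReluNet.Vec (h d) → ReluNet.Vec (h d) → ℝ)
        (S : ReluNet.Sample d h) (θ : ReluNet.Params h) (β p ε : ℝ),
        2 ≤ d → S.Nonempty →
        (∀ y a b, |l y a - l y b| ≤ β * ‖a - b‖) →
        ReluNet.IsNoiseStable S θ β p K (C * ReluNet.logFactor S θ β ε ^ k) ε →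
        C * ReluNet.logFactor S θ β ε ^ k / (ReluNet.minWidth d h : ℝ) < p → p ≤ 3 / 4 →
        (∀ i, 1 ≤ i → i < d → ∀ j,
          ‖ReluNet.column (θ i) j‖ ≤ K * Real.sqrt p * ReluNet.frob (θ i)) →
        Real.sqrt p * ε * ReluNet.logFactor S θ β ε ^ k ≤ K * (β * ReluNet.maxOutput S θ) →
        (1 / 4 ≤ (ReluNet.dropoutLaw d h p).real
            {w | ∀ t ∈ Set.Icc (0 : ℝ) 1,
              ReluNet.loss l S (ReluNet.onSegment θ (ReluNet.dropUpTo p w θ d) t) ≤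
                ReluNet.loss l S θ +
                  C * (Real.sqrt p * ε * ReluNet.logFactor S θ β ε ^ k)}) ∧
        (p = 3 / 4 → ReluNet.IsDropoutStable l S θ
          (C * (Real.sqrt p * ε * ReluNet.logFactor S θ β ε ^ k))) := by
  refine ⟨1, fun K hK => ⟨ReluNet.stabilityConstant K,
    by linarith [ReluNet.sixteen_le_stabilityConstant hK], ?_⟩⟩
  simp only [pow_one]
  intro d h l S θ β p ε hd hS hl hstable _ hp hcol hcond
  refine (lemma3_general hK hd hS hl hstable hp hcol hcond).imp_right fun hdrop hp34 =>
    hdrop hp34 (mul_le_mul_of_nonneg_right (ReluNet.sixteen_le_stabilityConstant hK) ?_)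
  obtain ⟨z, hz⟩ := id hS
  have hβ := ReluNet.lipschitz_const_nonneg hl (hstable.output_ne_zero z hz)
  exact zero_le_one.trans <| ReluNet.one_le_logFactor <| div_nonneg hβ <|
    hstable.eps_eq ▸ ReluNet.noiseParameter_nonneg hS hstable.output_ne_zero hd hβ
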